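/- Let $n\ge 1$, let $\mathfrak g=\mathfrak{so}(2,2+n)$ be the Lie algebra of $G=SO^0_{2,2+n}$ with Cartan involution $\theta X=-X^{T}$, Cartan decomposition $\mathfrak g=\mathfrak k\oplus\mathfrak p$ and Killing form $B$, and let $M=SO^0_{2,2+n}/SO_2SO_{2+n}=G/K$ be the complex hyperbolic quadric, with base point $o$ and the $G$-invariant Riemannian metric that is $B|_{\mathfrak p\times\mathfrak p}$ on $T_oM=\mathfrak p$. Let $\mathfrak a\subset\mathfrak p$ be any maximal abelian subspace, let $\Sigma^+$ be any choice of positive restricted roots (given by a regular element $H_0\in\mathfrak a$: $\Sigma^+=\{\lambda\in\Sigma:\lambda(H_0)>0\}$), let $\mathfrak n=\bigoplus_{\lambda\in\Sigma^+}\mathfrak g_\lambda$, and let $N$ be the nilpotent Iwasawa group, i.e. the connected Lie subgroup of $G$ with Lie algebra $\mathfrak n$. Then there is a connected Lie subgroup $S\subset N$ of codimension one, with Lie algebra $\mathfrak s\subset\mathfrak n$, such that $\dim S=2n+1$, $S$ is not abelian, and $S$ is a Ricci soliton with the induced metric, that is, with the left invariant metric $g$ that is induced from $M$ by the orbit map $S\to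 M$, $p\mapsto p\cdot o$ (so $g(X,Y)=B(X_{\mathfrak p},Y_{\mathfrak p})$ for $X,Y\in\mathfrak s$). More precisely, there are a real number $c$ and a smooth vector field $V$ on $S$ with $\mathrm{Ric}=c\,g+\mathcal L_V g$; and $S$ is a nilsoliton: the $(1,1)$-Ricci tensor of $(S,g)$ is $D+c'\,\mathrm{id}$ on $\mathfrak s$ for some $c'\in\mathbb R$ and some derivation $D$ of $\mathfrak s$. -/

import Mathlib

open scoped Matrix ContDiff

attribute [local instance 100] LieRing.ofAssociativeRing

noncomputable section

namespace IwasawaQuadric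

/-! ### Left invariant Riemannian metrics on Lie groups

A left invariant metric on a Lie group is an inner product `g` on its Lie algebra `L`; left
invariant vector fields are identified with the elements of `L`. -/

section LeftInvariant

variable {L : Type*} [LieRing L] [LieAlgebra ℝ L]

/-- `g` is an inner product on `L`. -/
def IsInnerProduct (g : LinearMap.BilinForm ℝ L) : Prop :=
  (∀ X Y, g X Y = g Y X) ∧ ∀ X, X ≠ 0 → 0 < g X X

/-- `nabla X Y = ∇_X Y` is the Levi-Civita connection of `g` on left invariant vector fields:
it is torsion free and compatible with the metric (`g Y Z` is constant for left invariant `Y`, `Z`).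
For an inner product `g` on a finite dimensional `L` there is exactly one such `nabla`. -/
def IsLeviCivita (g : LinearMap.BilinForm ℝ L) (nabla : L →ₗ[ℝ] L →ₗ[ℝ] L) : Prop :=
  (∀ X Y, nabla X Y - nabla Y X = ⁅X, Y⁆) ∧
    ∀ X Y Z, g (nabla X Y) Z + g Y (nabla X Z) = 0

/-- For fixed `Y`, `Z`, the endomorphism
`X ↦ R(X, Y) Z = ∇_X ∇_Y Z - ∇_Y ∇_X Z - ∇_{[X, Y]} Z`. -/
def curvature (nabla : L →ₗ[ℝ] L →ₗ[ℝ] L) (Y Z : L) : L →ₗ[ℝ] L where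
  toFun X := nabla X (nabla Y Z) - nabla Y (nabla X Z) - nabla ⁅X, Y⁆ Z
  map_add' X X' := by
    simp only [map_add, LinearMap.add_apply, add_lie]; abel
  map_smul' r X := by
    simp only [map_smul, LinearMap.smul_apply, smul_lie, smul_sub, RingHom.id_apply]

/-- The Ricci tensor `Ric(Y, Z)`, the trace of `X ↦ R(X, Y) Z`. -/
def ricci (nabla : L →ₗ[ℝ] L →ₗ[ℝ] L) (Y Z : L) : ℝ :=
  LinearMap.trace ℝ L (curvature nabla Y Z)

/-- Algebraic Ricci soliton: the `(1,1)`-Ricci tensor of the left invariant metric `g` is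
`D + c • id` for a derivation `D` of the Lie algebra and a real number `c`. -/
def IsAlgebraicRicciSoliton (g : LinearMap.BilinForm ℝ L) : Prop :=
  IsInnerProduct g ∧ ∃ nabla : L →ₗ[ℝ] L →ₗ[ℝ] L, IsLeviCivita g nabla ∧
    ∃ (D : LieDerivation ℝ L L) (c : ℝ), ∀ Y Z, ricci nabla Y Z = g (D Y + c • Y) Z

end LeftInvariant

/-! ### The group `SO⁰(2, 2 + n)` and its connected Lie subgroups -/

/-- The Lie algebra `𝔤 = 𝔰𝔬(2, 2 + n)` of real matrices, for the form `diag(1, 1, -1, …, -1)`. -/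
abbrev so2 (n : ℕ) : LieSubalgebra ℝ (Matrix (Fin 2 ⊕ Fin (2 + n)) (Fin 2 ⊕ Fin (2 + n)) ℝ) :=
  LieAlgebra.Orthogonal.so' (Fin 2) (Fin (2 + n)) ℝ

variable {n : ℕ}

/-- The exponential of an element of `𝔰𝔬(2, 2 + n)`, as an invertible matrix. -/
def expGL (X : so2 n) : GL (Fin 2 ⊕ Fin (2 + n)) ℝ :=
  (Matrix.isUnit_exp (X : Matrix (Fin 2 ⊕ Fin (2 + n)) (Fin 2 ⊕ Fin (2 + n)) ℝ)).unit

/-- The connected Lie subgroup with Lie algebra `s`: the group generated by `exp s`. For `s = ⊤`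
this is `SO⁰(2, 2 + n)`. -/
def connectedSubgroup (s : LieSubalgebra ℝ (so2 n)) : Subgroup (GL (Fin 2 ⊕ Fin (2 + n)) ℝ) :=
  Subgroup.closure {u | ∃ X ∈ s, u = expGL X}

/-- The exponential map of the connected Lie subgroup with Lie algebra `s`. -/
def expSub (s : LieSubalgebra ℝ (so2 n)) (X : s) : connectedSubgroup s :=
  ⟨expGL (X : so2 n), Subgroup.subset_closure ⟨X, X.2, rfl⟩⟩

/-- A real function on the connected Lie subgroup `S` with Lie algebra `s` is smooth, expressed
in the exponential coordinates `x ↦ p * exp (∑ i, x i • e i)` around each point `p` (for a basis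
`e` of `s`). These maps are smooth on all of `ℝᵈ` and are charts near `x = 0`. -/
def IsSmoothOn (s : LieSubalgebra ℝ (so2 n)) (f : connectedSubgroup s → ℝ) : Prop :=
  ∀ p : connectedSubgroup s,
    ContDiff ℝ ∞ (fun x : Fin (Module.finrank ℝ s) → ℝ =>
      f (p * expSub s (∑ i, x i • Module.finBasis ℝ s i)))

/-- The derivative at `p` of `f` in the direction of the left invariant vector field `Y`. -/
def leftDeriv (s : LieSubalgebra ℝ (so2 n)) (Y : s) (f : connectedSubgroup s → ℝ)
    (p : connectedSubgroup s) : ℝ :=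
  deriv (fun t : ℝ => f (p * expSub s (t • Y))) 0

/-- A vector field on the connected Lie subgroup `S` with Lie algebra `s`, in the left
trivialization: `V p : s` stands for the tangent vector at `p` that is the left translate of `V p`.
It is smooth if its products with all left invariant vector fields are. -/
def IsSmoothVectorField (s : LieSubalgebra ℝ (so2 n)) (g : LinearMap.BilinForm ℝ s)
    (V : connectedSubgroup s → s) : Prop :=
  ∀ Z : s, IsSmoothOn s (fun p => g (V p) Z)

/-- The Lie derivative `(𝓛_V g)(Y, Z) = V (g(Y, Z)) - g([V, Y], Z) - g(Y, [V, Z])` at `p`, for left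
invariant `Y`, `Z`. Here `g(Y, Z)` is constant, and `[V, Y]` is at `p` equal to
`⁅V p, Y⁆ - (Y V)(p)`, where `Y V` is the derivative of the `s`-valued function `V` along `Y`. -/
def lieDerivMetric (s : LieSubalgebra ℝ (so2 n)) (g : LinearMap.BilinForm ℝ s)
    (V : connectedSubgroup s → s) (p : connectedSubgroup s) (Y Z : s) : ℝ :=
  (leftDeriv s Y (fun q => g (V q) Z) p - g ⁅V p, Y⁆ Z) +
    (leftDeriv s Z (fun q => g Y (V q)) p - g Y ⁅V p, Z⁆)

/-- The connected Lie subgroup with Lie algebra `s`, with the left invariant Riemannian metric `g`,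
is a Ricci soliton: `Ric = c g + 𝓛_V g` for a real number `c` and a smooth vector field `V`. -/
def IsRicciSoliton (s : LieSubalgebra ℝ (so2 n)) (g : LinearMap.BilinForm ℝ s) : Prop :=
  IsInnerProduct g ∧ ∃ nabla : s →ₗ[ℝ] s →ₗ[ℝ] s, IsLeviCivita g nabla ∧
    ∃ (c : ℝ) (V : connectedSubgroup s → s), IsSmoothVectorField s g V ∧
      ∀ p Y Z, ricci nabla Y Z = c * g Y Z + lieDerivMetric s g V p Y Z

/-! ### The symmetric space and its Iwasawa groups -/

theorem neg_transpose_mem {A : Matrix (Fin 2 ⊕ Fin (2 + n)) (Fin 2 ⊕ Fin (2 + n)) ℝ}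
    (h : A ∈ so2 n) : -Aᵀ ∈ so2 n := by
  simp only [LieAlgebra.Orthogonal.so', mem_skewAdjointMatricesLieSubalgebra,
    mem_skewAdjointMatricesSubmodule, Matrix.IsSkewAdjoint, Matrix.IsAdjointPair] at h ⊢
  have hJ : (LieAlgebra.Orthogonal.indefiniteDiagonal (Fin 2) (Fin (2 + n)) ℝ) *
      LieAlgebra.Orthogonal.indefiniteDiagonal (Fin 2) (Fin (2 + n)) ℝ = 1 := by
    rw [LieAlgebra.Orthogonal.indefiniteDiagonal, Matrix.diagonal_mul_diagonal,
      ← Matrix.diagonal_one]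
    congr 1
    funext i
    rcases i with i | i <;> simp
  generalize LieAlgebra.Orthogonal.indefiniteDiagonal (Fin 2) (Fin (2 + n)) ℝ = J at h hJ ⊢
  have h2 : J * (Aᵀ * J) * J = J * (J * -A) * J := by rw [h]
  have h3 : J * Aᵀ = -(A * J) := by
    calc J * Aᵀ = J * (Aᵀ * J) * J := by
          rw [Matrix.mul_assoc, Matrix.mul_assoc, hJ, Matrix.mul_one]
      _ = -(A * J) := by
          rw [h2, ← Matrix.mul_assoc, hJ, Matrix.one_mul, Matrix.neg_mul]
  rw [Matrix.transpose_neg, Matrix.transpose_transpose, neg_neg, h3, Matrix.neg_mul]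

/-- The Cartan involution `θ X = -Xᵀ`; its fixed points form `𝔨 = 𝔰𝔬(2) ⊕ 𝔰𝔬(2 + n)`. -/
def theta : so2 n →ₗ[ℝ] so2 n where
  toFun X := ⟨-(X : Matrix (Fin 2 ⊕ Fin (2 + n)) (Fin 2 ⊕ Fin (2 + n)) ℝ)ᵀ,
    neg_transpose_mem X.2⟩
  map_add' X Y := Subtype.ext <| by
    change -(X.1 + Y.1)ᵀ = -X.1ᵀ + -Y.1ᵀ
    rw [Matrix.transpose_add, neg_add]
  map_smul' r X := Subtype.ext <| by
    change -(r • X.1)ᵀ = r • -X.1ᵀ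
    rw [Matrix.transpose_smul, smul_neg]

/-- The summand `𝔭` of the Cartan decomposition `𝔤 = 𝔨 ⊕ 𝔭`. -/
def pSpace (n : ℕ) : Submodule ℝ (so2 n) :=
  LinearMap.ker (theta + LinearMap.id : so2 n →ₗ[ℝ] so2 n)

/-- The projection of `𝔤 = 𝔨 ⊕ 𝔭` onto `𝔭` along `𝔨`. -/
def pProj (n : ℕ) : so2 n →ₗ[ℝ] so2 n :=
  (1 / 2 : ℝ) • (LinearMap.id - theta)

/-- `𝔞` is a maximal abelian subspace of `𝔭`. -/
def IsMaximalAbelian (a : Submodule ℝ (so2 n)) : Prop :=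
  Maximal (fun b : Submodule ℝ (so2 n) => b ≤ pSpace n ∧ ∀ X ∈ b, ∀ Y ∈ b, ⁅X, Y⁆ = 0) a

/-- The space `𝔤_μ = {X | [H, X] = μ(H) X for all H ∈ 𝔞}`. -/
def rootSpace (a : Submodule ℝ (so2 n)) (μ : Module.Dual ℝ a) : Submodule ℝ (so2 n) where
  carrier := {X | ∀ H : a, ⁅(H : so2 n), X⁆ = μ H • X}
  add_mem' {X Y} hX hY H := by
    rw [lie_add, hX H, hY H, smul_add]
  zero_mem' H := by simp
  smul_mem' r X hX H := by
    rw [lie_smul, hX H, smul_comm]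

/-- The set `Σ` of restricted roots. -/
def roots (a : Submodule ℝ (so2 n)) : Set (Module.Dual ℝ a) :=
  {μ | μ ≠ 0 ∧ rootSpace a μ ≠ ⊥}

/-- `H₀ ∈ 𝔞` is regular: no restricted root vanishes at `H₀`. Regular elements determine the
Weyl chambers, and thereby the possible choices of positive roots. -/
def IsRegularElement (a : Submodule ℝ (so2 n)) (H₀ : a) : Prop :=
  ∀ μ ∈ roots a, μ H₀ ≠ 0

/-- The set `Σ⁺` of restricted roots that are positive on the Weyl chamber of `H₀`. -/
def positiveRoots (a : Submodule ℝ (so2 n)) (H₀ : a) : Set (Module.Dual ℝ a) :=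
  {μ | μ ∈ roots a ∧ 0 < μ H₀}

theorem lie_mem_rootSpace (a : Submodule ℝ (so2 n)) {μ ν : Module.Dual ℝ a} {X Y : so2 n}
    (hX : X ∈ rootSpace a μ) (hY : Y ∈ rootSpace a ν) : ⁅X, Y⁆ ∈ rootSpace a (μ + ν) := by
  intro H
  rw [leibniz_lie, hX H, hY H, smul_lie, lie_smul, LinearMap.add_apply, add_smul]

/-- The sum `𝔫` of the root spaces of the positive roots. -/
def nilradical (a : Submodule ℝ (so2 n)) (H₀ : a) : LieSubalgebra ℝ (so2 n) where
  toSubmodule := ⨆ μ : positiveRoots a H₀, rootSpace a μ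
  lie_mem' {X Y} hX hY := by
    simp only [AddSubsemigroup.mem_carrier, AddSubmonoid.mem_toSubsemigroup,
      Submodule.mem_toAddSubmonoid] at hX hY ⊢
    induction hX using Submodule.iSup_induction' with
    | zero => rw [zero_lie]; exact Submodule.zero_mem _
    | add X X' _ _ h h' => rw [add_lie]; exact Submodule.add_mem _ h h'
    | mem μ X hX =>
      induction hY using Submodule.iSup_induction' with
      | zero => rw [lie_zero]; exact Submodule.zero_mem _
      | add Y Y' _ _ h h' => rw [lie_add]; exact Submodule.add_mem _ h h'
      | mem ν Y hY =>
        have h := lie_mem_rootSpace a hX hY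
        by_cases h0 : ⁅X, Y⁆ = 0
        · rw [h0]; exact Submodule.zero_mem _
        · have hpos : 0 < ((μ : Module.Dual ℝ a) + ν) H₀ := add_pos μ.2.2 ν.2.2
          have hmem : ((μ : Module.Dual ℝ a) + ν) ∈ positiveRoots a H₀ := by
            refine ⟨⟨?_, ?_⟩, hpos⟩
            · intro hz
              rw [hz] at hpos
              simp at hpos
            · intro hb
              rw [hb] at h
              exact h0 ((Submodule.mem_bot ℝ).1 h)
          exact Submodule.mem_iSup_of_mem
            (p := fun μ : positiveRoots a H₀ => rootSpace a μ) ⟨_, hmem⟩ h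

/-- The nilpotent Iwasawa group `N` of `SO⁰(2, 2 + n) = K A N`. -/
def iwasawaGroup (a : Submodule ℝ (so2 n)) (H₀ : a) : Subgroup (GL (Fin 2 ⊕ Fin (2 + n)) ℝ) :=
  connectedSubgroup (nilradical a H₀)

/-- The left invariant metric induced on the connected Lie subgroup `S` with Lie algebra `s` by the
orbit map `S → M = G/K`, `p ↦ p · o`, at the identity. The differential of `G → G/K` at the identity
is the projection of `𝔤` onto `𝔭 = T_o M`, and the metric of `M` at `o` is the restriction
of the Killing form of `𝔤` to `𝔭`. -/
def inducedMetric (s : LieSubalgebra ℝ (so2 n)) : LinearMap.BilinForm ℝ s :=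
  (killingForm ℝ (so2 n)).compl₁₂ (pProj n ∘ₗ s.toSubmodule.subtype)
    (pProj n ∘ₗ s.toSubmodule.subtype)

end IwasawaQuadric

end

/-! The restricted roots form a system of type B₂: `f 0` and `f 1` have multiplicity `n`, and `f 0 ±
f 1` have multiplicity one. Since `f 0 - f 1` is simple, deleting its root space from `𝔫` leaves a
subalgebra `𝔰` of codimension one. This is a Heisenberg algebra: the root spaces of `f 0` and `f 1`
pair into the line of `f 0 + f 1`, which is the center.

In the induced metric the root vectors are orthogonal and those of `f 0` and `f 1` have equal
length, so the bracket is a multiple of the Kähler form of a complex structure `J` on the complement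
of the center. The Ricci operator is then scalar on this complement and scalar on the center. The
derivations that are `d` on the complement and `2 d` on the center, together with `c • id`, provide
the two parameters that match both scalars (`IsHeisenberg.ricci_eq_dilation`). Products of three
matrices in `𝔰` vanish, so `exp` is a bijection onto the group, the Baker-Campbell-Hausdorff formula
stops after one bracket, and `V (exp X) = D X / 2` is an explicit soliton field
(`IsThreeStepNil.isRicciSoliton`).

For arbitrary `𝔞` and `H₀` the roots have to be found first. An element of `𝔭` is a linear map `ℝ² →
ℝ^(2+n)`, and the singular value decomposition of `H₀` yields joint eigenvectors of `𝔞`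
(`exists_adaptedFrame`). Regularity and maximality make the centralizer of `H₀` in `𝔭` equal to `𝔞`;
equal or vanishing singular values would put noncommuting elements into it. -/

noncomputable section

namespace IwasawaQuadric

variable {n : ℕ}

/-! ### Ricci curvature of Heisenberg algebras -/

section Heisenberg

variable {L : Type*} [LieRing L] [LieAlgebra ℝ L]

/-- `L` is a Heisenberg algebra with center `ℝ ζ`, where `η` is the coefficient of `ζ`, with the
inner product that is `κ η⁅X, J Y⁆` on the kernel of `η`, for a complex structure `J` of this
kernel, and such that `ζ` is orthogonal to the kernel and of square length `l`. -/
structure IsHeisenberg (g : LinearMap.BilinForm ℝ L) (J : L →ₗ[ℝ] L) (η : L →ₗ[ℝ] ℝ) (ζ : L)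
    (κ l : ℝ) : Prop where
  lie_eq : ∀ X Y : L, ⁅X, Y⁆ = η ⁅X, Y⁆ • ζ
  center_lie : ∀ Y : L, ⁅ζ, Y⁆ = 0
  apply_center : η ζ = 1
  J_center : J ζ = 0
  apply_J : ∀ X, η (J X) = 0
  J_J : ∀ X, J (J X) = η X • ζ - X
  trace_J : LinearMap.trace ℝ L J = 0
  metric : ∀ X Y, g X Y = κ * η ⁅X, J Y⁆ + l * (η X * η Y)
  inner : IsInnerProduct g
  scale_ne : κ ≠ 0
  length_ne : l ≠ 0

namespace IsHeisenberg

variable {g : LinearMap.BilinForm ℝ L} {J : L →ₗ[ℝ] L} {η : L →ₗ[ℝ] ℝ} {ζ : L} {κ l : ℝ}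

theorem apply_lie_center (h : IsHeisenberg g J η ζ κ l) (X : L) : η ⁅X, ζ⁆ = 0 := by
  rw [← lie_skew, h.center_lie, neg_zero, map_zero]

theorem apply_lie_skew (X Y : L) : η ⁅X, Y⁆ = -η ⁅Y, X⁆ := by
  rw [← lie_skew, map_neg]

/-- This is the symmetry of `g`, divided by `κ`. -/
theorem apply_lie_J_comm (h : IsHeisenberg g J η ζ κ l) (X Y : L) :
    η ⁅X, J Y⁆ = η ⁅Y, J X⁆ := by
  have := h.inner.1 X Y
  rw [h.metric, h.metric, mul_comm (η Y)] at this
  exact mul_left_cancel₀ h.scale_ne (add_right_cancel this)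

theorem apply_J_lie (h : IsHeisenberg g J η ζ κ l) (X Y : L) :
    η ⁅J X, Y⁆ = -η ⁅X, J Y⁆ := by
  rw [apply_lie_skew, h.apply_lie_J_comm]

theorem apply_J_lie_J (h : IsHeisenberg g J η ζ κ l) (X Y : L) :
    η ⁅J X, J Y⁆ = η ⁅X, Y⁆ := by
  rw [h.apply_J_lie, h.J_J, lie_sub, lie_smul, map_sub, map_smul, h.apply_lie_center]
  simp

variable (J η ζ κ l) in
/-- The Levi-Civita connection of the Heisenberg algebra. -/
def connection : L →ₗ[ℝ] L →ₗ[ℝ] L :=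
  LinearMap.mk₂ ℝ
    (fun X Y => (1 / 2 * η ⁅X, Y⁆) • ζ - (l / (2 * κ)) • (η Y • J X + η X • J Y))
    (fun X X' Y => by simp only [add_lie, map_add]; module)
    (fun r X Y => by simp only [smul_lie, map_smul, smul_eq_mul]; module)
    (fun X Y Y' => by simp only [lie_add, map_add]; module)
    (fun r X Y => by simp only [lie_smul, map_smul, smul_eq_mul]; module)

theorem connection_apply (X Y : L) : connection J η ζ κ l X Y =
    (1 / 2 * η ⁅X, Y⁆) • ζ - (l / (2 * κ)) • (η Y • J X + η X • J Y) := rfl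

/-- The formula for `connection` is what the Koszul identity gives: the factor `l / (2 κ)` converts
`g` of a bracket into `g` of `J`. -/
theorem isLeviCivita (h : IsHeisenberg g J η ζ κ l) :
    IsLeviCivita g (connection J η ζ κ l) := by
  refine ⟨fun X Y => ?_, fun X Y Z => ?_⟩
  · rw [connection_apply, connection_apply, apply_lie_skew Y X]
    nth_rw 3 [h.lie_eq]
    module
  · have hκ := h.scale_ne
    simp only [h.metric, connection_apply]
    simp only [map_sub, map_add, map_smul, sub_lie, lie_sub, lie_add, add_lie, smul_lie,
      lie_smul, smul_eq_mul, h.center_lie, h.apply_center, h.apply_J, h.J_center,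
      h.apply_J_lie_J, h.J_J, h.apply_lie_center, lie_zero, map_zero]
    rw [apply_lie_skew Y X]
    field_simp
    ring

theorem ricci_eq [FiniteDimensional ℝ L] (h : IsHeisenberg g J η ζ κ l) (Y W : L) :
    ricci (connection J η ζ κ l) Y W = -(l / (2 * κ)) * η ⁅Y, J W⁆ +
      (Module.finrank ℝ L - 1) * (l / (2 * κ)) ^ 2 * (η Y * η W) := by
  set β := l / (2 * κ) with hβ
  -- Every summand is a multiple of `J`, of the identity or of a rank one map, so its trace can be
  -- read off; `J` is traceless, and the maps `η ∘ ad` times `ζ` are traceless because `ζ` is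
  -- central.
  have key : curvature (connection J η ζ κ l) Y W =
      (-(1 / 2) * β * η ⁅Y, W⁆) • J
      - (β * η W / 2) • (η ∘ₗ LieModule.toEnd ℝ L L (- J Y)).smulRight ζ
      + (β ^ 2 * η W) • η.smulRight (J (J Y))
      + (β ^ 2 * η Y) • η.smulRight (J (J W))
      - (β * η Y / 2) • (η ∘ₗ LieModule.toEnd ℝ L L (- J W)).smulRight ζ
      - (β / 2) • (η ∘ₗ LieModule.toEnd ℝ L L W).smulRight (J Y)
      + (β * η W / 2) • (η ∘ₗ LieModule.toEnd ℝ L L Y ∘ₗ J).smulRight ζ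
      - (β ^ 2 * η W * η Y) • (η.smulRight ζ - LinearMap.id)
      + (β / 2 * η ⁅Y, J W⁆) • η.smulRight ζ
      - (β ^ 2 * η Y) • η.smulRight (J (J W))
      - β • (η ∘ₗ LieModule.toEnd ℝ L L Y).smulRight (J W) := by
    ext X
    have hXY := h.lie_eq X Y
    simp only [curvature, LinearMap.coe_mk, AddHom.coe_mk, connection_apply, LinearMap.add_apply,
      LinearMap.sub_apply, LinearMap.smul_apply, LinearMap.smulRight_apply, LinearMap.comp_apply,
      LieModule.toEnd_apply_apply, LinearMap.id_apply, ← hβ]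
    rw [hXY]
    simp only [map_sub, map_add, map_smul, lie_sub, lie_add, map_neg, neg_lie,
      smul_lie, lie_smul, smul_eq_mul, h.center_lie, h.apply_center, h.apply_J, h.J_center,
      h.J_J, h.apply_lie_center, map_zero]
    rw [apply_lie_skew (J Y) X, apply_lie_skew (J W) X, apply_lie_skew W X, apply_lie_skew Y X]
    module
  rw [ricci, key]
  simp only [map_sub, map_add, map_smul, LinearMap.trace_smulRight, h.trace_J,
    LinearMap.comp_apply, LieModule.toEnd_apply_apply, LinearMap.trace_id, h.apply_center,
    h.J_center, h.apply_J, h.apply_lie_center, map_zero, smul_eq_mul]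
  rw [apply_lie_skew W, h.apply_J_lie]
  ring

/-- The derivation of the Heisenberg algebra that is `d` on the kernel of `η` and `2 d` on the
center. -/
def dilation (h : IsHeisenberg g J η ζ κ l) (d : ℝ) : LieDerivation ℝ L L where
  toLinearMap := d • (LinearMap.id + η.smulRight ζ)
  leibniz' X Y := by
    simp only [LinearMap.smul_apply, LinearMap.add_apply, LinearMap.id_apply,
      LinearMap.smulRight_apply, lie_smul, lie_add, ← lie_skew X ζ, ← lie_skew Y ζ, h.center_lie,
      ← h.lie_eq X Y]
    rw [← lie_skew Y X]
    module

theorem dilation_apply (h : IsHeisenberg g J η ζ κ l) (d : ℝ) (X : L) :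
    h.dilation d X = d • (X + η X • ζ) := rfl

/-- Both sides are `2 d` times the bracket, since brackets are central and the central part of the
first factor does not contribute. In this form the derivation combines with the group law in
`exists_vectorField`. -/
theorem dilation_lie (h : IsHeisenberg g J η ζ κ l) (d : ℝ) (X Y : L) :
    h.dilation d ⁅X, Y⁆ = (2 : ℝ) • ⁅h.dilation d X, Y⁆ := by
  simp only [dilation_apply, smul_lie, add_lie, h.center_lie, ← h.lie_eq X Y]
  module

theorem dilation_symm (h : IsHeisenberg g J η ζ κ l) (d : ℝ) (X Y : L) :
    g (h.dilation d X) Y = g X (h.dilation d Y) := by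
  simp only [h.metric, dilation_apply]
  simp only [map_smul, map_add, smul_lie, add_lie, lie_smul, lie_add, h.center_lie, h.J_center,
    h.apply_center, smul_eq_mul, map_zero, lie_zero]
  ring

theorem ricci_eq_dilation [FiniteDimensional ℝ L] (h : IsHeisenberg g J η ζ κ l) :
    ∃ d c : ℝ, ∀ Y W, ricci (connection J η ζ κ l) Y W = g (h.dilation d Y + c • Y) W := by
  have hκ := h.scale_ne
  have hl := h.length_ne
  -- These solve `d + c = -l / (2 κ²)`, the Ricci eigenvalue on the kernel of `η`, and `2 d + c =
  -- (dim L - 1) l / (4 κ²)`, the one on the center.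
  refine ⟨(Module.finrank ℝ L + 1) * l / (4 * κ ^ 2), -(Module.finrank ℝ L + 3) * l / (4 * κ ^ 2),
    fun Y W => ?_⟩
  simp only [h.ricci_eq, h.metric, dilation_apply]
  simp only [map_smul, map_add, smul_lie, add_lie,
    h.center_lie, h.apply_center, smul_eq_mul, map_zero]
  field_simp
  ring

theorem isAlgebraicRicciSoliton [FiniteDimensional ℝ L] (h : IsHeisenberg g J η ζ κ l) :
    IsAlgebraicRicciSoliton g := by
  obtain ⟨d, c, hR⟩ := h.ricci_eq_dilation
  exact ⟨h.inner, _, h.isLeviCivita, h.dilation d, c, hR⟩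

end IsHeisenberg

end Heisenberg

/-! ### The Killing form as a trace form, and the induced metric -/

section Killing

variable {ι : Type*}

theorem transposeLinearEquiv_toLinearMap_apply (A : Matrix ι ι ℝ) :
    (Matrix.transposeLinearEquiv ι ι ℝ ℝ).toLinearMap A = Aᵀ := rfl

variable [Fintype ι] [DecidableEq ι]

theorem trace_matrix_end (f : Matrix ι ι ℝ →ₗ[ℝ] Matrix ι ι ℝ) :
    LinearMap.trace ℝ (Matrix ι ι ℝ) f = ∑ i, ∑ j, f (Matrix.single i j 1) i j := by
  rw [LinearMap.trace_eq_matrix_trace ℝ (Matrix.stdBasis ℝ ι ι), Matrix.trace,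
    Fintype.sum_prod_type]
  refine Finset.sum_congr rfl fun i _ => Finset.sum_congr rfl fun j _ => ?_
  rw [Matrix.diag_apply, LinearMap.toMatrix_apply, Matrix.stdBasis_eq_single]
  rfl

theorem mul_single_one_mul_apply (A B : Matrix ι ι ℝ) (i j k l : ι) :
    (A * Matrix.single i j (1 : ℝ) * B) k l = A k i * B j l := by
  rw [Matrix.single_eq_single_vecMulVec_single, Matrix.mul_vecMulVec, Matrix.vecMulVec_mul,
    Matrix.vecMulVec_apply]
  simp

theorem trace_mulLeft_mulRight (A B : Matrix ι ι ℝ) :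
    LinearMap.trace ℝ (Matrix ι ι ℝ) (LinearMap.mulLeft ℝ A ∘ₗ LinearMap.mulRight ℝ B) =
      A.trace * B.trace := by
  simp only [trace_matrix_end, LinearMap.comp_apply, LinearMap.mulLeft_apply,
    LinearMap.mulRight_apply, ← mul_assoc, mul_single_one_mul_apply, Matrix.trace,
    Matrix.diag_apply, Finset.sum_mul_sum]

theorem trace_mulLeft_mulRight_transpose (A B : Matrix ι ι ℝ) :
    LinearMap.trace ℝ (Matrix ι ι ℝ) (LinearMap.mulLeft ℝ A ∘ₗ LinearMap.mulRight ℝ B ∘ₗ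
      (Matrix.transposeLinearEquiv ι ι ℝ ℝ).toLinearMap) = (A * Bᵀ).trace := by
  simp only [trace_matrix_end, LinearMap.comp_apply, LinearMap.mulLeft_apply,
    LinearMap.mulRight_apply, ← mul_assoc,
    transposeLinearEquiv_toLinearMap_apply, Matrix.transpose_single, mul_single_one_mul_apply]
  simp only [Matrix.trace, Matrix.diag_apply, Matrix.mul_apply, Matrix.transpose_apply]

end Killing

/-- The matrix of the indefinite form of signature `(2, 2 + n)`. -/
abbrev J (n : ℕ) : Matrix (Fin 2 ⊕ Fin (2 + n)) (Fin 2 ⊕ Fin (2 + n)) ℝ :=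
  LieAlgebra.Orthogonal.indefiniteDiagonal (Fin 2) (Fin (2 + n)) ℝ

theorem J_mul_J : J n * J n = 1 := by
  unfold J
  rw [LieAlgebra.Orthogonal.indefiniteDiagonal, Matrix.diagonal_mul_diagonal,
    ← Matrix.diagonal_one]
  congr 1
  funext i
  rcases i with i | i <;> simp

theorem J_mul_J_assoc (A : Matrix (Fin 2 ⊕ Fin (2 + n)) (Fin 2 ⊕ Fin (2 + n)) ℝ) :
    J n * (J n * A) = A := by
  rw [← Matrix.mul_assoc, J_mul_J, Matrix.one_mul]

theorem transpose_J : (J n)ᵀ = J n := Matrix.diagonal_transpose _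

theorem mem_so2_iff {A : Matrix (Fin 2 ⊕ Fin (2 + n)) (Fin 2 ⊕ Fin (2 + n)) ℝ} :
    A ∈ so2 n ↔ Aᵀ * J n = -(J n * A) := by
  simp only [LieAlgebra.Orthogonal.so', mem_skewAdjointMatricesLieSubalgebra,
    mem_skewAdjointMatricesSubmodule, Matrix.IsSkewAdjoint, Matrix.IsAdjointPair, Matrix.mul_neg]

theorem transpose_mul_J (X : so2 n) : (X.1)ᵀ * J n = -(J n * X.1) := mem_so2_iff.1 X.2

/-- The projection `Z ↦ (Z - J Zᵀ J) / 2` of all matrices to `𝔰𝔬(2, 2 + n)`. -/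
def soProj (n : ℕ) : Matrix (Fin 2 ⊕ Fin (2 + n)) (Fin 2 ⊕ Fin (2 + n)) ℝ →ₗ[ℝ]
    Matrix (Fin 2 ⊕ Fin (2 + n)) (Fin 2 ⊕ Fin (2 + n)) ℝ :=
  (1 / 2 : ℝ) • (LinearMap.id - LinearMap.mulLeft ℝ (J n) ∘ₗ LinearMap.mulRight ℝ (J n) ∘ₗ
    (Matrix.transposeLinearEquiv _ _ ℝ ℝ).toLinearMap)

theorem soProj_apply (Z : Matrix (Fin 2 ⊕ Fin (2 + n)) (Fin 2 ⊕ Fin (2 + n)) ℝ) :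
    soProj n Z = (1 / 2 : ℝ) • (Z - J n * (Zᵀ * J n)) := rfl

theorem soProj_mem (Z : Matrix (Fin 2 ⊕ Fin (2 + n)) (Fin 2 ⊕ Fin (2 + n)) ℝ) :
    soProj n Z ∈ so2 n := by
  rw [mem_so2_iff, soProj_apply]
  simp only [Matrix.transpose_smul, Matrix.transpose_sub, Matrix.transpose_mul, transpose_J,
    Matrix.transpose_transpose, Matrix.smul_mul, Matrix.mul_smul, Matrix.sub_mul, Matrix.mul_sub,
    Matrix.mul_assoc, J_mul_J_assoc, J_mul_J, Matrix.mul_one]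
  module

theorem soProj_of_mem (X : so2 n) : soProj n X = X := by
  rw [soProj_apply, transpose_mul_J, Matrix.mul_neg, J_mul_J_assoc]
  module

/-- `soProj` is a projection onto `𝔰𝔬(2, 2 + n)`, so composing with it loses no trace. Traces on the
Lie algebra become traces on all matrices, and no basis of the Lie algebra is needed. -/
theorem trace_so2 (f : Matrix (Fin 2 ⊕ Fin (2 + n)) (Fin 2 ⊕ Fin (2 + n)) ℝ →ₗ[ℝ]
    Matrix (Fin 2 ⊕ Fin (2 + n)) (Fin 2 ⊕ Fin (2 + n)) ℝ) (T : so2 n →ₗ[ℝ] so2 n)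
    (h : ∀ X : so2 n, (T X : Matrix (Fin 2 ⊕ Fin (2 + n)) (Fin 2 ⊕ Fin (2 + n)) ℝ) = f X) :
    LinearMap.trace ℝ (so2 n) T = LinearMap.trace ℝ _ (f ∘ₗ soProj n) := by
  have hf : ∀ Z, (f ∘ₗ soProj n) Z ∈ (so2 n).toSubmodule := fun Z => by
    have := h ⟨_, soProj_mem Z⟩
    rw [LinearMap.comp_apply, ← this]
    exact (T _).2
  rw [← LinearMap.trace_restrict_eq_of_forall_mem (so2 n).toSubmodule _ hf]
  congr 1
  ext1 X
  refine Subtype.ext ?_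
  rw [h X]
  change f X = f (soProj n X)
  rw [soProj_of_mem]

theorem trace_so2_mem (X : so2 n) : X.1.trace = 0 := by
  have h := congrArg Matrix.trace (congrArg (J n * ·) (transpose_mul_J X))
  simp only [Matrix.mul_neg, J_mul_J_assoc, Matrix.trace_neg] at h
  rw [Matrix.trace_mul_comm, Matrix.mul_assoc, J_mul_J, Matrix.mul_one,
    Matrix.trace_transpose] at h
  linarith

/-- Expand `ad X ad Y` as `Z ↦ X Y Z - X Z Y - Y Z X + Z Y X` and compose with `soProj`. The
identity part contributes `2 (n + 4) tr (X Y)`, because `X` and `Y` are traceless; the transposed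
part contributes `4 tr (X Y)`, one from each term. Half the difference is `(n + 2) tr (X Y)`. -/
theorem killingForm_eq (X Y : so2 n) :
    killingForm ℝ (so2 n) X Y = (n + 2) * (X.1 * Y.1).trace := by
  rw [killingForm_apply_apply, trace_so2
    (LinearMap.mulLeft ℝ (X.1 * Y.1) ∘ₗ LinearMap.mulRight ℝ 1
      - LinearMap.mulLeft ℝ X.1 ∘ₗ LinearMap.mulRight ℝ Y.1
      - LinearMap.mulLeft ℝ Y.1 ∘ₗ LinearMap.mulRight ℝ X.1
      + LinearMap.mulLeft ℝ 1 ∘ₗ LinearMap.mulRight ℝ (Y.1 * X.1))]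
  · have key : (LinearMap.mulLeft ℝ (X.1 * Y.1) ∘ₗ LinearMap.mulRight ℝ 1
      - LinearMap.mulLeft ℝ X.1 ∘ₗ LinearMap.mulRight ℝ Y.1
      - LinearMap.mulLeft ℝ Y.1 ∘ₗ LinearMap.mulRight ℝ X.1
      + LinearMap.mulLeft ℝ 1 ∘ₗ LinearMap.mulRight ℝ (Y.1 * X.1)) ∘ₗ soProj n =
      (1 / 2 : ℝ) • ((LinearMap.mulLeft ℝ (X.1 * Y.1) ∘ₗ LinearMap.mulRight ℝ 1
      - LinearMap.mulLeft ℝ X.1 ∘ₗ LinearMap.mulRight ℝ Y.1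
      - LinearMap.mulLeft ℝ Y.1 ∘ₗ LinearMap.mulRight ℝ X.1
      + LinearMap.mulLeft ℝ 1 ∘ₗ LinearMap.mulRight ℝ (Y.1 * X.1))
      - (LinearMap.mulLeft ℝ (X.1 * Y.1 * J n) ∘ₗ LinearMap.mulRight ℝ (J n) ∘ₗ
          (Matrix.transposeLinearEquiv _ _ ℝ ℝ).toLinearMap
      - LinearMap.mulLeft ℝ (X.1 * J n) ∘ₗ LinearMap.mulRight ℝ (J n * Y.1) ∘ₗ
          (Matrix.transposeLinearEquiv _ _ ℝ ℝ).toLinearMap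
      - LinearMap.mulLeft ℝ (Y.1 * J n) ∘ₗ LinearMap.mulRight ℝ (J n * X.1) ∘ₗ
          (Matrix.transposeLinearEquiv _ _ ℝ ℝ).toLinearMap
      + LinearMap.mulLeft ℝ (J n) ∘ₗ LinearMap.mulRight ℝ (J n * (Y.1 * X.1)) ∘ₗ
          (Matrix.transposeLinearEquiv _ _ ℝ ℝ).toLinearMap)) := by
      refine LinearMap.ext fun Z => ?_
      simp only [LinearMap.comp_apply, LinearMap.add_apply, LinearMap.sub_apply,
        LinearMap.smul_apply, LinearMap.mulLeft_apply, LinearMap.mulRight_apply, soProj_apply,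
        transposeLinearEquiv_toLinearMap_apply, Matrix.mul_smul, Matrix.smul_mul,
        Matrix.mul_sub, Matrix.sub_mul, Matrix.mul_assoc, Matrix.mul_one, Matrix.one_mul]
      module
    rw [key]
    simp only [map_smul, map_add, map_sub, trace_mulLeft_mulRight,
      trace_mulLeft_mulRight_transpose, Matrix.transpose_mul, transpose_J, Matrix.mul_assoc,
      J_mul_J_assoc, J_mul_J, Matrix.mul_one, Matrix.mul_neg, Matrix.trace_neg,
      transpose_mul_J, Matrix.trace_one, smul_eq_mul]
    have hJ : J n * (X.1ᵀ * (J n * Y.1)) = -(X.1 * Y.1) := by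
      rw [← Matrix.mul_assoc X.1ᵀ, transpose_mul_J, Matrix.neg_mul, Matrix.mul_neg,
        Matrix.mul_assoc, J_mul_J_assoc]
    rw [Matrix.trace_mul_comm Y.1 X.1, hJ, Matrix.trace_neg, trace_so2_mem, Fintype.card_sum,
      Fintype.card_fin, Fintype.card_fin]
    push_cast
    ring
  · intro Z
    simp only [LinearMap.comp_apply, LinearMap.add_apply, LinearMap.sub_apply,
        LinearMap.mulLeft_apply, LinearMap.mulRight_apply, LieAlgebra.ad_apply,
        LieSubalgebra.coe_bracket, LieRing.of_associative_ring_bracket]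
    noncomm_ring

/-- The bilinear form on `𝔰𝔬(2, 2 + n)` that is the metric of the symmetric space on the `𝔭`-parts. -/
def projMetric (n : ℕ) : LinearMap.BilinForm ℝ (so2 n) :=
  (killingForm ℝ (so2 n)).compl₁₂ (pProj n) (pProj n)

theorem projMetric_apply (X Y : so2 n) :
    projMetric n X Y = (n + 2) / 2 * ((X.1 * Y.1).trace + (X.1 * Y.1ᵀ).trace) := by
  have hp (X : so2 n) : (pProj n X).1 = (1 / 2 : ℝ) • (X.1 - -X.1ᵀ) := rfl
  rw [projMetric, LinearMap.compl₁₂_apply, killingForm_eq, hp, hp]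
  simp only [Matrix.smul_mul, Matrix.mul_smul, sub_neg_eq_add, Matrix.add_mul, Matrix.mul_add,
    Matrix.trace_smul, Matrix.trace_add, smul_eq_mul]
  rw [← Matrix.trace_transpose (X.1ᵀ * Y.1), ← Matrix.trace_transpose (X.1ᵀ * Y.1ᵀ),
    Matrix.transpose_mul, Matrix.transpose_mul, Matrix.transpose_transpose,
    Matrix.transpose_transpose, Matrix.trace_mul_comm Y.1 X.1, Matrix.trace_mul_comm Y.1ᵀ X.1]
  ring

theorem inducedMetric_apply (s : LieSubalgebra ℝ (so2 n)) (X Y : s) :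
    inducedMetric s X Y = projMetric n X Y := rfl

/-! ### Exponential coordinates and the soliton vector field -/

section Group

theorem bilin_add_left {M : Type*} [LieRing M] [LieAlgebra ℝ M] (g : LinearMap.BilinForm ℝ M)
    (X Y Z : M) : g (X + Y) Z = g X Z + g Y Z := by
  rw [map_add, LinearMap.add_apply]

theorem bilin_smul_left {M : Type*} [LieRing M] [LieAlgebra ℝ M] (g : LinearMap.BilinForm ℝ M)
    (r : ℝ) (X Z : M) : g (r • X) Z = r * g X Z := by
  rw [map_smul, LinearMap.smul_apply, smul_eq_mul]

/-- `Z` and `W` stand for the brackets of the vector field with the two arguments: they cancel in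
the Lie derivative of the metric, which leaves the symmetric part of `D`. -/
theorem symm_derivation_eq {M : Type*} [LieRing M] [LieAlgebra ℝ M] {g : LinearMap.BilinForm ℝ M}
    (hg : IsInnerProduct g) {D : M →ₗ[ℝ] M} (hD : ∀ X Y, g (D X) Y = g X (D Y)) (c : ℝ)
    (X Y Z W : M) : g (D X + c • X) Y = c * g X Y + ((g ((1 / 2 : ℝ) • D X + Z) Y - g Z Y) +
      (g ((1 / 2 : ℝ) • D Y + W) X - g X W)) := by
  simp only [bilin_add_left, bilin_smul_left]
  rw [hD Y X, hg.1 Y (D X), hg.1 X W]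
  ring

/-- All products of three matrices in `s` vanish. -/
def IsThreeStepNil (s : LieSubalgebra ℝ (so2 n)) : Prop :=
  ∀ X ∈ s, ∀ Y ∈ s, ∀ Z ∈ s, X.1 * Y.1 * Z.1 = 0

theorem exp_of_cube_eq_zero {ι : Type*} [Fintype ι] [DecidableEq ι] {A : Matrix ι ι ℝ}
    (h : A * A * A = 0) : NormedSpace.exp A = 1 + A + (1 / 2 : ℝ) • (A * A) := by
  rw [congrFun (NormedSpace.exp_eq_tsum ℝ) A, tsum_eq_sum (s := Finset.range 3)]
  · simp [Finset.sum_range_succ, pow_two, Nat.factorial]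
  · intro k hk
    obtain ⟨m, rfl⟩ := Nat.exists_eq_add_of_le (not_lt.1 (Finset.mem_range.not.1 hk))
    rw [pow_add, pow_three', h, Matrix.zero_mul, smul_zero]

variable {s : LieSubalgebra ℝ (so2 n)}

theorem leftDeriv_of_affine {V : connectedSubgroup s → s} {T : connectedSubgroup s → s →ₗ[ℝ] s}
    (hV : ∀ p Y, V (p * expSub s Y) = V p + T p Y) (g : LinearMap.BilinForm ℝ s)
    (p : connectedSubgroup s) (Y Z : s) : leftDeriv s Y (fun q => g (V q) Z) p = g (T p Y) Z := by
  have hf : (fun t : ℝ => g (V (p * expSub s (t • Y))) Z) = fun t : ℝ =>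
      g (V p) Z + t * g (T p Y) Z := by
    funext t
    rw [hV, (T p).map_smul, bilin_add_left, bilin_smul_left]
  rw [leftDeriv, hf]
  simp

/-- The field is affine in the exponential coordinates around every point, not just at the identity.
-/
theorem isSmoothVectorField_of_affine {V : connectedSubgroup s → s}
    {T : connectedSubgroup s → s →ₗ[ℝ] s} (hV : ∀ p Y, V (p * expSub s Y) = V p + T p Y)
    (g : LinearMap.BilinForm ℝ s) : IsSmoothVectorField s g V := by
  intro Z p
  let ℓ : (Fin (Module.finrank ℝ s) → ℝ) →ₗ[ℝ] ℝ :=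
    (g.flip Z ∘ₗ T p) ∘ₗ Fintype.linearCombination ℝ (Module.finBasis ℝ s)
  have hf : (fun x : Fin (Module.finrank ℝ s) → ℝ =>
      g (V (p * expSub s (∑ i, x i • Module.finBasis ℝ s i))) Z) = fun x =>
      g (V p) Z + LinearMap.toContinuousLinearMap ℓ x := by
    funext x
    rw [hV]
    exact bilin_add_left g (V p) _ Z
  rw [hf]
  exact contDiff_const.add (ContinuousLinearMap.contDiff _)

namespace IsThreeStepNil

theorem coe_expGL (hs : IsThreeStepNil s) {X : so2 n} (hX : X ∈ s) :
    (expGL X).1 = 1 + X.1 + (1 / 2 : ℝ) • (X.1 * X.1) :=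
  exp_of_cube_eq_zero (hs X hX X hX X hX)

/-- Baker-Campbell-Hausdorff: double brackets are sums of triple products, hence zero, and all
exponentials are quadratic polynomials. -/
theorem expGL_mul (hs : IsThreeStepNil s) {X Y : so2 n} (hX : X ∈ s) (hY : Y ∈ s) :
    expGL X * expGL Y = expGL (X + Y + (1 / 2 : ℝ) • ⁅X, Y⁆) := by
  have hXY : X + Y + (1 / 2 : ℝ) • ⁅X, Y⁆ ∈ s :=
    s.add_mem (s.add_mem hX hY) (s.smul_mem _ (s.lie_mem hX hY))
  refine Units.ext ?_
  rw [Units.val_mul, hs.coe_expGL hX, hs.coe_expGL hY, hs.coe_expGL hXY]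
  have h2 := hs X hX X hX Y hY
  have h3 := hs X hX Y hY X hX
  have h4 := hs X hX Y hY Y hY
  have h5 := hs Y hY X hX X hX
  have h6 := hs Y hY X hX Y hY
  have h7 := hs Y hY Y hY X hX
  have hc : (X + Y + (1 / 2 : ℝ) • ⁅X, Y⁆).1 =
    X.1 + Y.1 + (1 / 2 : ℝ) • (X.1 * Y.1 - Y.1 * X.1) := rfl
  rw [hc]
  simp only [Matrix.mul_assoc] at h2 h3 h4 h5 h6 h7
  simp only [Matrix.add_mul, Matrix.mul_add, Matrix.sub_mul, Matrix.mul_sub, Matrix.smul_mul,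
    Matrix.mul_smul, Matrix.mul_assoc, Matrix.one_mul, Matrix.mul_one, h2, h3, h4, h5, h6, h7,
    Matrix.mul_zero, smul_zero, sub_zero, add_zero]
  module

/-- By the product formula `exp s` is already closed under multiplication and inversion. -/
theorem exists_expGL (hs : IsThreeStepNil s) {p : GL (Fin 2 ⊕ Fin (2 + n)) ℝ}
    (hp : p ∈ connectedSubgroup s) : ∃ X ∈ s, p = expGL X := by
  have h0 : expGL (0 : so2 n) = 1 := Units.ext NormedSpace.exp_zero
  induction hp using Subgroup.closure_induction with
  | mem p hp => exact hp
  | one => exact ⟨0, s.zero_mem, h0.symm⟩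
  | mul p q _ _ hp hq =>
    obtain ⟨X, hX, rfl⟩ := hp
    obtain ⟨Y, hY, rfl⟩ := hq
    exact ⟨_, s.add_mem (s.add_mem hX hY) (s.smul_mem _ (s.lie_mem hX hY)), hs.expGL_mul hX hY⟩
  | inv p _ hp =>
    obtain ⟨X, hX, rfl⟩ := hp
    refine ⟨-X, s.neg_mem hX, inv_eq_of_mul_eq_one_right ?_⟩
    rw [hs.expGL_mul hX (s.neg_mem hX), lie_neg, lie_self, neg_zero, smul_zero, add_zero,
      add_neg_cancel, h0]

/-- The truncated logarithm `N - N² / 2` with `N = exp X - 1` recovers `X`. -/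
theorem expGL_injective (hs : IsThreeStepNil s) {X Y : so2 n} (hX : X ∈ s) (hY : Y ∈ s)
    (h : expGL X = expGL Y) : X = Y := by
  have key {X : so2 n} (hX : X ∈ s) : X.1 = ((expGL X).1 - 1) -
      (1 / 2 : ℝ) • (((expGL X).1 - 1) * ((expGL X).1 - 1)) := by
    have h := hs X hX X hX X hX
    rw [Matrix.mul_assoc] at h
    rw [hs.coe_expGL hX, add_assoc, add_sub_cancel_left]
    simp only [Matrix.add_mul, Matrix.mul_add, Matrix.smul_mul, Matrix.mul_smul, Matrix.mul_assoc,
      h, Matrix.mul_zero, smul_zero, add_zero]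
    module
  exact Subtype.ext (by rw [key hX, key hY, h])

theorem exists_expSub (hs : IsThreeStepNil s) (p : connectedSubgroup s) :
    ∃ X : s, p = expSub s X := by
  obtain ⟨X, hX, h⟩ := hs.exists_expGL p.2
  exact ⟨⟨X, hX⟩, Subtype.ext h⟩

/-- The logarithm of the group of a nilpotent algebra of matrices. -/
def log (hs : IsThreeStepNil s) (p : connectedSubgroup s) : s := (hs.exists_expSub p).choose

theorem expSub_log (hs : IsThreeStepNil s) (p : connectedSubgroup s) :
    expSub s (hs.log p) = p := (hs.exists_expSub p).choose_spec.symm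

theorem log_expSub (hs : IsThreeStepNil s) (X : s) : hs.log (expSub s X) = X :=
  Subtype.ext (hs.expGL_injective (hs.log _).2 X.2 (congrArg Subtype.val (hs.expSub_log _)))

theorem log_mul_expSub (hs : IsThreeStepNil s) (p : connectedSubgroup s) (Y : s) :
    hs.log (p * expSub s Y) = hs.log p + Y + (1 / 2 : ℝ) • ⁅hs.log p, Y⁆ := by
  conv_lhs => rw [← hs.expSub_log p]
  have h : expSub s (hs.log p) * expSub s Y =
      expSub s (hs.log p + Y + (1 / 2 : ℝ) • ⁅hs.log p, Y⁆) :=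
    Subtype.ext (hs.expGL_mul (hs.log p).2 Y.2)
  rw [h, hs.log_expSub]

theorem exists_vectorField (hs : IsThreeStepNil s) (D : s →ₗ[ℝ] s)
    (hD : ∀ X Y : s, D ⁅X, Y⁆ = (2 : ℝ) • ⁅D X, Y⁆) :
    ∃ (V : connectedSubgroup s → s) (T : connectedSubgroup s → s →ₗ[ℝ] s),
      (∀ p Y, T p Y = (1 / 2 : ℝ) • D Y + ⁅V p, Y⁆) ∧
      ∀ p Y, V (p * expSub s Y) = V p + T p Y := by
  -- With `X = log p`, the term `D ⁅X, Y⁆ / 4` from the product formula equals `⁅D X, Y⁆ / 2 = ⁅V p,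
  -- Y⁆`.
  refine ⟨fun p => (1 / 2 : ℝ) • D (hs.log p), fun p => (1 / 2 : ℝ) • D +
    LieModule.toEnd ℝ s s ((1 / 2 : ℝ) • D (hs.log p)), fun p Y => rfl, fun p Y => ?_⟩
  have hT : ((1 / 2 : ℝ) • D + LieModule.toEnd ℝ s s ((1 / 2 : ℝ) • D (hs.log p))) Y =
      (1 / 2 : ℝ) • D Y + ⁅(1 / 2 : ℝ) • D (hs.log p), Y⁆ := rfl
  change (1 / 2 : ℝ) • D (hs.log (p * expSub s Y)) = _
  rw [hT, hs.log_mul_expSub, D.map_add, D.map_add, D.map_smul, hD, smul_lie]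
  module

/-- A left invariant metric whose Ricci operator is `D + c • id`, for a symmetric derivation `D`
with `D ⁅X, Y⁆ = 2 ⁅D X, Y⁆`, is a Ricci soliton: the vector field generating the automorphisms
with differential `exp (t D / 2)` solves the soliton equation. -/
theorem isRicciSoliton (hs : IsThreeStepNil s) {g : LinearMap.BilinForm ℝ s}
    (hg : IsInnerProduct g) {nabla : s →ₗ[ℝ] s →ₗ[ℝ] s} (hn : IsLeviCivita g nabla)
    (D : s →ₗ[ℝ] s) (c : ℝ) (hD : ∀ X Y : s, D ⁅X, Y⁆ = (2 : ℝ) • ⁅D X, Y⁆)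
    (hDg : ∀ X Y, g (D X) Y = g X (D Y))
    (hR : ∀ Y Z, ricci nabla Y Z = g (D Y + c • Y) Z) : IsRicciSoliton s g := by
  obtain ⟨V, T, hT, hV⟩ := hs.exists_vectorField D hD
  refine ⟨hg, nabla, hn, c, V, isSmoothVectorField_of_affine hV g, fun p Y Z => ?_⟩
  have hcomm : (fun q => g Y (V q)) = fun q => g (V q) Y := funext fun q => hg.1 _ _
  rw [lieDerivMetric, leftDeriv_of_affine hV, hcomm, leftDeriv_of_affine hV, hR, hT, hT]
  exact symm_derivation_eq hg hDg c Y Z _ _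

end IsThreeStepNil

end Group

/-! ### Root vectors from pairs of weight vectors -/

section RootVectors

/-- The space `ℝ^{2, 2 + n}`. -/
abbrev Vec (n : ℕ) : Type := Fin 2 ⊕ Fin (2 + n) → ℝ

theorem J_mulVec_elim (u : Fin 2 → ℝ) (v : Fin (2 + n) → ℝ) :
    J n *ᵥ Sum.elim u v = Sum.elim u (-v) := by
  ext i
  rcases i with i | i <;> simp [J, LieAlgebra.Orthogonal.indefiniteDiagonal, Matrix.mulVec_diagonal]

theorem J_mulVec_J (u : Vec n) : J n *ᵥ (J n *ᵥ u) = u := by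
  rw [Matrix.mulVec_mulVec, J_mul_J, Matrix.one_mulVec]

theorem dotProduct_mulVec_of_symm {A : Matrix (Fin 2 ⊕ Fin (2 + n)) (Fin 2 ⊕ Fin (2 + n)) ℝ}
    (hA : Aᵀ = A) (u v : Vec n) : u ⬝ᵥ A *ᵥ v = A *ᵥ u ⬝ᵥ v := by
  rw [Matrix.dotProduct_mulVec, ← Matrix.mulVec_transpose, hA]

theorem dotProduct_J (u v : Vec n) : u ⬝ᵥ J n *ᵥ v = J n *ᵥ u ⬝ᵥ v :=
  dotProduct_mulVec_of_symm transpose_J u v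

theorem mem_pSpace_iff {X : so2 n} : X ∈ pSpace n ↔ X.1ᵀ = X.1 := by
  rw [pSpace, LinearMap.mem_ker, LinearMap.add_apply, LinearMap.id_apply, ← Subtype.coe_inj]
  change -X.1ᵀ + X.1 = 0 ↔ _
  rw [neg_add_eq_zero]

theorem mulVec_J_of_symm {X : so2 n} (hX : X.1ᵀ = X.1) (u : Vec n) :
    X.1 *ᵥ (J n *ᵥ u) = -(J n *ᵥ (X.1 *ᵥ u)) := by
  have h := transpose_mul_J X
  rw [hX] at h
  rw [Matrix.mulVec_mulVec, Matrix.mulVec_mulVec, h, Matrix.neg_mulVec]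

/-- The element `u vᵀ - (J v) (J u)ᵀ` of `𝔰𝔬(2, 2 + n)`. -/
def rootVec (u v : Vec n) : so2 n :=
  ⟨Matrix.vecMulVec u v - Matrix.vecMulVec (J n *ᵥ v) (J n *ᵥ u), by
    rw [mem_so2_iff]
    simp only [Matrix.transpose_sub, Matrix.transpose_vecMulVec, Matrix.sub_mul, Matrix.mul_sub,
      Matrix.mul_vecMulVec, Matrix.vecMulVec_mul, J_mulVec_J]
    rw [← Matrix.mulVec_transpose, ← Matrix.mulVec_transpose, transpose_J, J_mulVec_J, neg_sub]⟩

theorem coe_rootVec (u v : Vec n) : (rootVec u v).1 =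
    Matrix.vecMulVec u v - Matrix.vecMulVec (J n *ᵥ v) (J n *ᵥ u) := rfl

theorem rootVec_mulVec (u v t : Vec n) :
    (rootVec u v).1 *ᵥ t = (v ⬝ᵥ t) • u - (J n *ᵥ u ⬝ᵥ t) • (J n *ᵥ v) := by
  rw [coe_rootVec, Matrix.sub_mulVec, Matrix.vecMulVec_mulVec, Matrix.vecMulVec_mulVec,
    op_smul_eq_smul, op_smul_eq_smul]

/-- A symmetric `H` in the algebra anticommutes with `J`, so `J u` and `J v` have eigenvalues `-α`
and `-β`, and both dyads scale by `α - β`. -/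
theorem lie_rootVec {H : so2 n} (hH : H.1ᵀ = H.1) {u v : Vec n} {α β : ℝ}
    (hu : H.1 *ᵥ u = α • u) (hv : H.1 *ᵥ v = β • v) :
    ⁅H, rootVec u v⁆ = (α - β) • rootVec u v := by
  refine Subtype.ext ?_
  change H.1 * (rootVec u v).1 - (rootVec u v).1 * H.1 = (α - β) • (rootVec u v).1
  rw [coe_rootVec]
  simp only [Matrix.sub_mul, Matrix.mul_sub, Matrix.mul_vecMulVec, Matrix.vecMulVec_mul]
  simp only [← Matrix.mulVec_transpose, hH, mulVec_J_of_symm hH, hu, hv, Matrix.mulVec_smul]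
  simp only [← neg_smul, Matrix.smul_vecMulVec, Matrix.vecMulVec_smul]
  module

theorem rootVec_mem_rootSpace {a : Submodule ℝ (so2 n)} (ha : a ≤ pSpace n) {u v : Vec n}
    {χ ψ : Module.Dual ℝ a} (hu : ∀ H : a, H.1.1 *ᵥ u = χ H • u)
    (hv : ∀ H : a, H.1.1 *ᵥ v = ψ H • v) : rootVec u v ∈ rootSpace a (χ - ψ) :=
  fun H => lie_rootVec (mem_pSpace_iff.1 (ha H.2)) (hu H) (hv H)

theorem rootVec_mem_pSpace {x y : Vec n} (hx : J n *ᵥ x = x) (hy : J n *ᵥ y = -y) :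
    rootVec x y ∈ pSpace n := by
  rw [mem_pSpace_iff, coe_rootVec, hx, hy, Matrix.transpose_sub, Matrix.transpose_vecMulVec,
    Matrix.transpose_vecMulVec, Matrix.neg_vecMulVec, Matrix.vecMulVec_neg, sub_neg_eq_add,
    sub_neg_eq_add]
  exact add_comm _ _

end RootVectors

/-! ### The centralizer of a regular element -/

section Centralizer

variable {a : Submodule ℝ (so2 n)}

/-- Commuting symmetric operators are simultaneously diagonalizable; in this form linear statements
can be checked on joint eigenvectors. -/
theorem eq_top_of_joint_eigenvectors (hp : a ≤ pSpace n)
    (hc : ∀ X ∈ a, ∀ Y ∈ a, ⁅X, Y⁆ = 0) (S : Submodule ℝ (Vec n))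
    (hS : ∀ v : Vec n, (∀ H : a, ∃ c : ℝ, H.1.1 *ᵥ v = c • v) → v ∈ S) : S = ⊤ := by
  let e := WithLp.linearEquiv 2 ℝ (Vec n)
  let T (H : a) : EuclideanSpace ℝ (Fin 2 ⊕ Fin (2 + n)) →ₗ[ℝ]
    EuclideanSpace ℝ (Fin 2 ⊕ Fin (2 + n)) := Matrix.toEuclideanLin H.1.1
  have hT (H : a) (v) : e (T H v) = H.1.1 *ᵥ e v := rfl
  have h1 : ∀ H, (T H).IsSymmetric := fun H =>
    Matrix.isSymmetric_toEuclideanLin_iff.2 (mem_pSpace_iff.1 (hp H.2))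
  have h2 : Pairwise (Function.onFun Commute T) := by
    intro H H' _
    refine LinearMap.ext fun v => e.injective ?_
    have h := congrArg (fun A : so2 n => A.1 *ᵥ e v) (hc H.1 H.2 H'.1 H'.2)
    change (H.1.1 * H'.1.1 - H'.1.1 * H.1.1) *ᵥ e v = (0 : Matrix _ _ ℝ) *ᵥ e v at h
    rw [Matrix.sub_mulVec, Matrix.zero_mulVec, sub_eq_zero] at h
    simpa only [Module.End.mul_apply, hT, Matrix.mulVec_mulVec] using h
  have h3 := LinearMap.IsSymmetric.iSup_iInf_eq_top_of_commute h1 h2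
  have h4 : S.comap e.toLinearMap = ⊤ := by
    rw [eq_top_iff, ← h3]
    refine iSup_le fun χ v hv => hS _ fun H => ⟨χ H, ?_⟩
    have h := Module.End.mem_eigenspace_iff.1 ((Submodule.mem_iInf _).1 hv H)
    exact congrArg e h
  rw [eq_top_iff]
  intro v _
  have h : e.symm v ∈ S.comap e.toLinearMap := h4 ▸ Submodule.mem_top
  simpa using h

theorem exists_weight {v : Vec n} (hv : v ≠ 0) (h : ∀ H : a, ∃ c : ℝ, H.1.1 *ᵥ v = c • v) :
    ∃ χ : Module.Dual ℝ a, ∀ H : a, H.1.1 *ᵥ v = χ H • v := by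
  choose c hc using h
  refine ⟨⟨⟨c, fun H H' => ?_⟩, fun r H => ?_⟩, hc⟩
  · refine smul_left_injective ℝ hv ?_
    change c (H + H') • v = (c H + c H') • v
    rw [← hc, add_smul, ← hc, ← hc]
    exact Matrix.add_mulVec _ _ _
  · refine smul_left_injective ℝ hv ?_
    change c (r • H) • v = (r • c H) • v
    rw [← hc, smul_assoc, ← hc]
    exact Matrix.smul_mulVec _ _ _

/-- Between vectors of weights `χ` and `ψ`, the commutator with `H` has coefficient `(ψ H - χ H) ⟨u,
X v⟩`. If this is nonzero, commuting with `H₀` gives `χ H₀ = ψ H₀`, so by regularity the nonzero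
functional `χ - ψ` is not a root. Then `rootVec u v = 0`, which forces `u` to be parallel to `J v`;
but `⟨J v, X v⟩ = 0` for `X ∈ 𝔭`. -/
theorem commute_of_commute_regular (hp : a ≤ pSpace n)
    (hc : ∀ X ∈ a, ∀ Y ∈ a, ⁅X, Y⁆ = 0) {H₀ : a} (hH₀ : IsRegularElement a H₀) {X : so2 n}
    (hX : X ∈ pSpace n) (h : X.1 * H₀.1.1 = H₀.1.1 * X.1) (H : a) :
    X.1 * H.1.1 = H.1.1 * X.1 := by
  have hsym (H : a) := mem_pSpace_iff.1 (hp H.2)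
  have key : ∀ u v : Vec n, (∀ H : a, ∃ c : ℝ, H.1.1 *ᵥ u = c • u) →
      (∀ H : a, ∃ c : ℝ, H.1.1 *ᵥ v = c • v) →
      u ⬝ᵥ (X.1 * H.1.1 - H.1.1 * X.1) *ᵥ v = 0 := by
    intro u v hu hv
    rcases eq_or_ne u 0 with rfl | hu0
    · simp
    rcases eq_or_ne v 0 with rfl | hv0
    · simp
    obtain ⟨χ, hχ⟩ := exists_weight hu0 hu
    obtain ⟨ψ, hψ⟩ := exists_weight hv0 hv
    have hform (H : a) : u ⬝ᵥ (X.1 * H.1.1 - H.1.1 * X.1) *ᵥ v =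
        (ψ H - χ H) * (u ⬝ᵥ X.1 *ᵥ v) := by
      rw [Matrix.sub_mulVec, dotProduct_sub, ← Matrix.mulVec_mulVec, ← Matrix.mulVec_mulVec, hψ,
        dotProduct_mulVec_of_symm (hsym H), hχ, Matrix.mulVec_smul, dotProduct_smul,
        smul_dotProduct, smul_eq_mul, smul_eq_mul]
      ring
    rw [hform]
    by_contra hne
    obtain ⟨hne1, hne2⟩ := mul_ne_zero_iff.1 hne
    have h0 := hform H₀
    rw [h, sub_self, Matrix.zero_mulVec, dotProduct_zero] at h0
    have h0' : ψ H₀ - χ H₀ = 0 := (mul_eq_zero.1 h0.symm).resolve_right hne2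
    refine hH₀ (χ - ψ) ⟨fun hz => hne1 ?_, fun hbot => ?_⟩ ?_
    · have := congrArg (fun f : Module.Dual ℝ a => f H) hz
      simp only [LinearMap.sub_apply, LinearMap.zero_apply] at this
      linarith
    · have hr : rootVec u v = 0 := by
        rw [← Submodule.mem_bot ℝ, ← hbot]
        exact rootVec_mem_rootSpace hp hχ hψ
      have h1 : (rootVec u v).1 *ᵥ v = 0 := by rw [hr]; exact Matrix.zero_mulVec v
      rw [rootVec_mulVec, sub_eq_zero] at h1
      have h2 : v ⬝ᵥ v ≠ 0 := fun h => hv0 (dotProduct_self_eq_zero.1 h)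
      have h3 : J n *ᵥ v ⬝ᵥ X.1 *ᵥ v = 0 := by
        have hX' := mem_pSpace_iff.1 hX
        have h4 : J n *ᵥ v ⬝ᵥ X.1 *ᵥ v = -(J n *ᵥ v ⬝ᵥ X.1 *ᵥ v) := by
          conv_lhs => rw [dotProduct_mulVec_of_symm hX', mulVec_J_of_symm hX', neg_dotProduct,
            ← dotProduct_J, dotProduct_comm]
        linarith
      refine hne2 ((mul_eq_zero.1 (?_ : (v ⬝ᵥ v) * _ = 0)).resolve_left h2)
      rw [← smul_eq_mul, ← smul_dotProduct, h1, smul_dotProduct, h3, smul_zero]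
    · rw [LinearMap.sub_apply]
      linarith
  have hmem {A : Matrix (Fin 2 ⊕ Fin (2 + n)) (Fin 2 ⊕ Fin (2 + n)) ℝ}
      (hA : ∀ u v : Vec n, u ⬝ᵥ A *ᵥ v = 0) : A = 0 := by
    refine Matrix.ext_of_mulVec_single fun i => ?_
    rw [Matrix.zero_mulVec]
    exact dotProduct_self_eq_zero.1 (hA _ _)
  rw [← sub_eq_zero]
  refine hmem fun u v => ?_
  set A := X.1 * H.1.1 - H.1.1 * X.1
  have hr : ∀ u : Vec n, (∀ H : a, ∃ c : ℝ, H.1.1 *ᵥ u = c • u) → ∀ v, u ⬝ᵥ A *ᵥ v = 0 := by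
    intro u hu v
    let φ : Vec n →ₗ[ℝ] ℝ := dotProductBilin ℝ ℝ u ∘ₗ A.mulVecLin
    have h := eq_top_of_joint_eigenvectors hp hc (LinearMap.ker φ) fun v hv => key u v hu hv
    have hv : v ∈ LinearMap.ker φ := h ▸ Submodule.mem_top
    exact hv
  let φ : Vec n →ₗ[ℝ] ℝ := dotProductBilin ℝ ℝ (A *ᵥ v)
  have h := eq_top_of_joint_eigenvectors hp hc (LinearMap.ker φ) fun u hu => by
    rw [LinearMap.mem_ker]
    change A *ᵥ v ⬝ᵥ u = 0
    rw [dotProduct_comm, hr u hu]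
  have hv : u ∈ LinearMap.ker φ := h ▸ Submodule.mem_top
  rw [dotProduct_comm]
  exact hv

/-- Adjoining `X` to `𝔞` keeps it abelian inside `𝔭`, so maximality applies. -/
theorem mem_of_commute_regular (ha : IsMaximalAbelian a) {H₀ : a} (hH₀ : IsRegularElement a H₀)
    {X : so2 n} (hX : X ∈ pSpace n) (h : X.1 * H₀.1.1 = H₀.1.1 * X.1) : X ∈ a := by
  have hp := ha.prop.1
  have hc := ha.prop.2
  have hXa : ∀ H ∈ a, ⁅X, H⁆ = 0 := fun H hH =>
    Subtype.ext (sub_eq_zero.2 (commute_of_commute_regular hp hc hH₀ hX h ⟨H, hH⟩))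
  refine ha.le_of_ge (y := a ⊔ ℝ ∙ X) ⟨sup_le hp ?_, ?_⟩ le_sup_left
    (Submodule.mem_sup_right (Submodule.mem_span_singleton_self X))
  · rwa [Submodule.span_singleton_le_iff_mem]
  · intro Y hY Z hZ
    obtain ⟨H, hH, Y', hY', rfl⟩ := Submodule.mem_sup.1 hY
    obtain ⟨H', hH', Z', hZ', rfl⟩ := Submodule.mem_sup.1 hZ
    obtain ⟨r, rfl⟩ := Submodule.mem_span_singleton.1 hY'
    obtain ⟨r', rfl⟩ := Submodule.mem_span_singleton.1 hZ'
    rw [add_lie, lie_add, lie_add, hc H hH H' hH', lie_smul, ← lie_skew, hXa H hH, smul_lie,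
      hXa H' hH', smul_lie, lie_smul, lie_self]
    simp

end Centralizer

/-! ### Joint eigenvectors from the singular value decomposition -/

section Frame

theorem mulVec_J_eq_self {u : Vec n} (h : J n *ᵥ u = u) : ∃ x : Fin 2 → ℝ, u = Sum.elim x 0 := by
  refine ⟨u ∘ Sum.inl, ?_⟩
  rw [← Sum.elim_comp_inl_inr u, J_mulVec_elim] at h
  have h2 := congrArg (· ∘ Sum.inr) h
  simp only [Sum.elim_comp_inr] at h2
  conv_lhs => rw [← Sum.elim_comp_inl_inr u, self_eq_neg.1 h2.symm]

theorem mulVec_J_eq_neg {u : Vec n} (h : J n *ᵥ u = -u) :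
    ∃ y : Fin (2 + n) → ℝ, u = Sum.elim (0 : Fin 2 → ℝ) y := by
  refine ⟨u ∘ Sum.inr, ?_⟩
  rw [← Sum.elim_comp_inl_inr u, J_mulVec_elim] at h
  have h2 := congrArg (· ∘ Sum.inl) h
  simp only [Sum.elim_comp_inl] at h2
  have h3 : u ∘ Sum.inl = 0 := self_eq_neg.1 h2
  conv_lhs => rw [← Sum.elim_comp_inl_inr u, h3]

theorem elim_zero_dotProduct (u v : Fin 2 → ℝ) :
    (Sum.elim u 0 : Vec n) ⬝ᵥ Sum.elim v 0 = u ⬝ᵥ v := by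
  simp [dotProduct]

theorem zero_elim_dotProduct (u v : Fin (2 + n) → ℝ) :
    (Sum.elim 0 u : Vec n) ⬝ᵥ Sum.elim 0 v = u ⬝ᵥ v := by
  simp [dotProduct]

theorem vec_dotProduct_self_nonneg (u : Vec n) : 0 ≤ u ⬝ᵥ u :=
  Finset.sum_nonneg fun _ _ => mul_self_nonneg _

/-- Commuting with `J`, the matrix preserves the positive plane `ℝ²`, where its block `H.toBlocks₁₁`
has an orthonormal eigenbasis. The permutation `σ` in the proof only puts the eigenvalues in order.
-/
theorem exists_eigenvectors {H : Matrix (Fin 2 ⊕ Fin (2 + n)) (Fin 2 ⊕ Fin (2 + n)) ℝ}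
    (hH : Hᵀ = H) (hJ : ∀ u, J n *ᵥ (H *ᵥ u) = H *ᵥ (J n *ᵥ u)) :
    ∃ (x : Fin 2 → Vec n) (t : Fin 2 → ℝ), (∀ i j, x i ⬝ᵥ x j = if i = j then 1 else 0) ∧
      (∀ i, J n *ᵥ x i = x i) ∧ (∀ i, H *ᵥ x i = t i • x i) ∧ t 1 ≤ t 0 ∧
      ∀ v, J n *ᵥ v = v → (∀ i, x i ⬝ᵥ v = 0) → v = 0 := by
  have hM : H.toBlocks₁₁.IsHermitian := by
    ext i j
    exact congrFun (congrFun hH (Sum.inl i)) (Sum.inl j)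
  let b := hM.eigenvectorBasis
  have hb (i j : Fin 2) : (b i).ofLp ⬝ᵥ (b j).ofLp = if i = j then 1 else 0 := by
    have h := orthonormal_iff_ite.1 b.orthonormal i j
    rw [EuclideanSpace.inner_eq_star_dotProduct, dotProduct_comm] at h
    exact h
  have hc (u : Fin 2 → ℝ) (h : ∀ i, (b i).ofLp ⬝ᵥ u = 0) : u = 0 := by
    have h2 : WithLp.toLp 2 u = (0 : EuclideanSpace ℝ (Fin 2)) := by
      refine InnerProductSpace.ext_inner_left_basis b.toBasis fun i => ?_
      rw [EuclideanSpace.inner_eq_star_dotProduct, dotProduct_comm, inner_zero_right]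
      exact h i
    exact congrArg WithLp.ofLp h2
  have he (i : Fin 2) : H *ᵥ (Sum.elim (b i).ofLp 0 : Vec n) =
      hM.eigenvalues i • (Sum.elim (b i).ofLp 0 : Vec n) := by
    have h1 : J n *ᵥ (H *ᵥ (Sum.elim (b i).ofLp 0 : Vec n)) = H *ᵥ Sum.elim (b i).ofLp 0 := by
      rw [hJ, J_mulVec_elim, neg_zero]
    obtain ⟨z, hz⟩ := mulVec_J_eq_self h1
    have h2 := hM.mulVec_eigenvectorBasis i
    have h3 : z = H.toBlocks₁₁ *ᵥ (b i).ofLp := by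
      rw [← H.fromBlocks_toBlocks, Matrix.fromBlocks_mulVec] at hz
      have := congrArg (· ∘ Sum.inl) hz
      simpa using this.symm
    rw [hz, h3, h2]
    ext k
    rcases k with k | k <;> simp [b]
  have main (σ : Equiv.Perm (Fin 2)) (h : hM.eigenvalues (σ 1) ≤ hM.eigenvalues (σ 0)) :
    ∃ (x : Fin 2 → Vec n) (t : Fin 2 → ℝ), (∀ i j, x i ⬝ᵥ x j = if i = j then 1 else 0) ∧
      (∀ i, J n *ᵥ x i = x i) ∧ (∀ i, H *ᵥ x i = t i • x i) ∧ t 1 ≤ t 0 ∧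
      ∀ v, J n *ᵥ v = v → (∀ i, x i ⬝ᵥ v = 0) → v = 0 := by
    refine ⟨fun i => Sum.elim (b (σ i)).ofLp 0, fun i => hM.eigenvalues (σ i), fun i j => ?_,
      fun i => by rw [J_mulVec_elim, neg_zero], fun i => he _, h, fun v hv h => ?_⟩
    · rw [elim_zero_dotProduct, hb]
      simp only [σ.apply_eq_iff_eq]
    · obtain ⟨u, rfl⟩ := mulVec_J_eq_self hv
      rw [hc u fun i => ?_, Sum.elim_zero_zero]
      have := h (σ.symm i)
      rwa [elim_zero_dotProduct, σ.apply_symm_apply] at this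
  rcases le_total (hM.eigenvalues 1) (hM.eigenvalues 0) with h | h
  · exact main 1 h
  · exact main (Equiv.swap 0 1) (by simpa using h)

theorem exists_extend_orthonormal (s : Set (Fin (2 + n))) (y : Fin (2 + n) → Vec n)
    (hy : ∀ i ∈ s, ∀ j ∈ s, y i ⬝ᵥ y j = if i = j then 1 else 0)
    (hJ : ∀ i ∈ s, J n *ᵥ y i = -y i) :
    ∃ b : Fin (2 + n) → Vec n, (∀ i ∈ s, b i = y i) ∧
      (∀ i j, b i ⬝ᵥ b j = if i = j then 1 else 0) ∧ (∀ i, J n *ᵥ b i = -b i) ∧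
      ∀ v, J n *ᵥ v = -v → (∀ i, b i ⬝ᵥ v = 0) → v = 0 := by
  have hz : ∀ i ∈ s, y i = Sum.elim (0 : Fin 2 → ℝ) (y i ∘ Sum.inr) := fun i hi => by
    obtain ⟨z, hz⟩ := mulVec_J_eq_neg (hJ i hi)
    rw [hz, Sum.elim_comp_inr]
  let v (i : Fin (2 + n)) : EuclideanSpace ℝ (Fin (2 + n)) := WithLp.toLp 2 (y i ∘ Sum.inr)
  have hv : Orthonormal ℝ (s.domRestrict v) := by
    rw [orthonormal_iff_ite]
    rintro ⟨i, hi⟩ ⟨j, hj⟩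
    have h := hy j hj i hi
    rw [hz i hi, hz j hj, zero_elim_dotProduct] at h
    simp only [Set.domRestrict_apply, EuclideanSpace.inner_eq_star_dotProduct, Subtype.mk.injEq,
      eq_comm (a := i)]
    exact h
  obtain ⟨b, hb⟩ := hv.exists_orthonormalBasis_extension_of_card_eq (by simp)
  refine ⟨fun i => Sum.elim 0 (b i).ofLp, fun i hi => ?_, fun i j => ?_, fun i => ?_,
    fun u hu h => ?_⟩
  · dsimp only
    rw [hb i hi, hz i hi]
  · have h := orthonormal_iff_ite.1 b.orthonormal i j
    rw [EuclideanSpace.inner_eq_star_dotProduct, dotProduct_comm] at h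
    rw [zero_elim_dotProduct]
    exact h
  · rw [J_mulVec_elim]
    ext k
    rcases k with k | k <;> simp
  · obtain ⟨z, rfl⟩ := mulVec_J_eq_neg hu
    have h2 : WithLp.toLp 2 z = (0 : EuclideanSpace ℝ (Fin (2 + n))) := by
      refine InnerProductSpace.ext_inner_left_basis b.toBasis fun i => ?_
      rw [EuclideanSpace.inner_eq_star_dotProduct, dotProduct_comm, inner_zero_right]
      have := h i
      rw [zero_elim_dotProduct] at this
      exact this
    have h3 : z = 0 := congrArg WithLp.ofLp h2
    rw [h3, Sum.elim_zero_zero]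

variable {a : Submodule ℝ (so2 n)}

/-- `e 0, e 1, J e 0, J e 1, w 0, …, w (n - 1)` is an orthogonal basis of joint eigenvectors of `a`,
and the weights of `e 0`, `e 1` are positive and in decreasing order on `H₀`. -/
structure IsAdaptedFrame (a : Submodule ℝ (so2 n)) (H₀ : a) (e : Fin 2 → Vec n) (w : Fin n → Vec n)
    (f : Fin 2 → Module.Dual ℝ a) : Prop where
  e_e : ∀ i j, e i ⬝ᵥ e j = if i = j then 2 else 0
  e_Je : ∀ i j, e i ⬝ᵥ J n *ᵥ e j = 0
  e_w : ∀ i j, e i ⬝ᵥ w j = 0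
  w_w : ∀ i j, w i ⬝ᵥ w j = if i = j then 1 else 0
  J_w : ∀ i, J n *ᵥ w i = -w i
  complete : ∀ v, (∀ i, e i ⬝ᵥ v = 0) → (∀ i, J n *ᵥ e i ⬝ᵥ v = 0) → (∀ i, w i ⬝ᵥ v = 0) → v = 0
  mulVec_e : ∀ (H : a) i, H.1.1 *ᵥ e i = f i H • e i
  mulVec_w : ∀ (H : a) i, H.1.1 *ᵥ w i = 0
  pos : 0 < f 1 H₀
  lt : f 1 H₀ < f 0 H₀

theorem commute_of_mem (ha : IsMaximalAbelian a) {X Y : so2 n} (hX : X ∈ a) (hY : Y ∈ a)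
    (u : Vec n) :
    X.1 *ᵥ (Y.1 *ᵥ u) = Y.1 *ᵥ (X.1 *ᵥ u) := by
  have h := congrArg (fun A : so2 n => A.1 *ᵥ u) (ha.prop.2 X hX Y hY)
  change (X.1 * Y.1 - Y.1 * X.1) *ᵥ u = (0 : Matrix _ _ ℝ) *ᵥ u at h
  rw [Matrix.sub_mulVec, Matrix.zero_mulVec, sub_eq_zero] at h
  simpa only [Matrix.mulVec_mulVec] using h

theorem mem_of_mulVec_commute (ha : IsMaximalAbelian a) {H₀ : a} (hH₀ : IsRegularElement a H₀)
    {X : so2 n} (hX : X ∈ pSpace n)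
    (h : ∀ u, X.1 *ᵥ (H₀.1.1 *ᵥ u) = H₀.1.1 *ᵥ (X.1 *ᵥ u)) : X ∈ a := by
  refine mem_of_commute_regular ha hH₀ hX (Matrix.ext_of_mulVec_single fun i => ?_)
  simpa only [Matrix.mulVec_mulVec] using h (Pi.single i 1)

/-- The smaller singular value of a regular element does not vanish. -/
theorem regular_mulVec_ne_zero (hn : 1 ≤ n) (ha : IsMaximalAbelian a) {H₀ : a}
    (hH₀ : IsRegularElement a H₀) {x : Fin 2 → Vec n}
    (hx : ∀ i j, x i ⬝ᵥ x j = if i = j then 1 else 0) (hJx : ∀ i, J n *ᵥ x i = x i)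
    (hc : ∀ v, J n *ᵥ v = v → (∀ i, x i ⬝ᵥ v = 0) → v = 0) : H₀.1.1 *ᵥ x 1 ≠ 0 := by
  intro h1
  have hsym := mem_pSpace_iff.1 (ha.prop.1 H₀.2)
  set y := H₀.1.1 *ᵥ x 0 with hy
  have hJy : J n *ᵥ y = -y := by
    rw [hy, ← neg_eq_iff_eq_neg, ← mulVec_J_of_symm hsym, hJx]
  -- An orthonormal basis of the negative space whose first vector spans `y`; the case `y = 0` takes
  -- any basis and `c = 0`.
  have hb : ∃ (b : Fin (2 + n) → Vec n) (c : ℝ), y = c • b 0 ∧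
      (∀ i j, b i ⬝ᵥ b j = if i = j then 1 else 0) ∧ ∀ i, J n *ᵥ b i = -b i := by
    rcases eq_or_ne y 0 with h0 | h0
    · obtain ⟨b, -, h2, h3, -⟩ := exists_extend_orthonormal (n := n) ∅ (fun _ => 0) (by simp)
        (by simp)
      exact ⟨b, 0, by rw [h0, zero_smul], h2, h3⟩
    · have hp : 0 < y ⬝ᵥ y :=
        lt_of_le_of_ne (vec_dotProduct_self_nonneg y)
          (Ne.symm fun h => h0 (dotProduct_self_eq_zero.1 h))
      set r := Real.sqrt (y ⬝ᵥ y) with hr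
      have hr0 : 0 < r := Real.sqrt_pos.2 hp
      have hr2 : r * r = y ⬝ᵥ y := Real.mul_self_sqrt hp.le
      obtain ⟨b, h1, h2, h3, -⟩ := exists_extend_orthonormal (n := n) {0} (fun _ => r⁻¹ • y)
        (by
          rintro i rfl j rfl
          rw [if_pos rfl, smul_dotProduct, dotProduct_smul, ← hr2, smul_eq_mul, smul_eq_mul]
          field_simp)
        (by
          rintro i rfl
          rw [Matrix.mulVec_smul, hJy, smul_neg])
      exact ⟨b, r, by rw [h1 0 rfl, smul_inv_smul₀ hr0.ne'], h2, h3⟩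
  obtain ⟨b, c, hyb, hbb, hJb⟩ := hb
  have hxb (i k) : x i ⬝ᵥ b k = 0 := by
    have h := dotProduct_J (x i) (b k)
    rw [hJb, hJx, dotProduct_neg] at h
    linarith
  have hHb (k) (hk : k ≠ 0) : H₀.1.1 *ᵥ b k = 0 := by
    refine hc _ ?_ fun i => ?_
    · rw [← neg_inj, ← mulVec_J_of_symm hsym, hJb, Matrix.mulVec_neg]
    · rw [dotProduct_mulVec_of_symm hsym]
      fin_cases i
      · change y ⬝ᵥ b k = 0
        rw [hyb, smul_dotProduct, hbb, if_neg hk.symm, smul_zero]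
      · change H₀.1.1 *ᵥ x 1 ⬝ᵥ b k = 0
        rw [h1, zero_dotProduct]
  -- `H₀` kills both `x 1` and `b k`, so these elements of `𝔭` centralize it.
  have hmem (k) (hk : k ≠ 0) : rootVec (x 1) (b k) ∈ a := by
    refine mem_of_mulVec_commute ha hH₀ (rootVec_mem_pSpace (hJx 1) (hJb k)) fun u => ?_
    simp only [rootVec_mulVec, dotProduct_mulVec_of_symm hsym, hJx, hJb, Matrix.mulVec_sub,
      Matrix.mulVec_smul, Matrix.mulVec_neg, hHb k hk, h1, zero_dotProduct, zero_smul, neg_zero,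
      smul_zero]
  -- Two further indices exist because `n ≥ 1`; the corresponding elements of `𝔞` do not commute, as
  -- seen on `b k₂`.
  let k₁ : Fin (2 + n) := ⟨1, by omega⟩
  let k₂ : Fin (2 + n) := ⟨2, by omega⟩
  have hk₁ : k₁ ≠ 0 := by simp [k₁, Fin.ext_iff]
  have hk₂ : k₂ ≠ 0 := by simp [k₂, Fin.ext_iff]
  have hk : k₁ ≠ k₂ := by simp [k₁, k₂]
  have h := congrArg (b k₁ ⬝ᵥ ·) (commute_of_mem ha (hmem k₁ hk₁) (hmem k₂ hk₂) (b k₂))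
  simp [rootVec_mulVec, hJx, hJb, hxb, hx, hbb, hk,
    dotProduct_comm (b _) (x _)] at h

/-- The singular values of a regular element are different. -/
theorem regular_singular_value_ne (ha : IsMaximalAbelian a) {H₀ : a}
    (hH₀ : IsRegularElement a H₀) {x y : Fin 2 → Vec n} {t : ℝ}
    (hx : ∀ i j, x i ⬝ᵥ x j = if i = j then 1 else 0) (hJx : ∀ i, J n *ᵥ x i = x i)
    (hy : ∀ i j, y i ⬝ᵥ y j = if i = j then 1 else 0) (hJy : ∀ i, J n *ᵥ y i = -y i)
    (hHx : ∀ i, H₀.1.1 *ᵥ x i = t • y i) (hHy : ∀ i, H₀.1.1 *ᵥ y i = t • x i) : False := by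
  have hsym := mem_pSpace_iff.1 (ha.prop.1 H₀.2)
  have hxy (i k) : x i ⬝ᵥ y k = 0 := by
    have h := dotProduct_J (x i) (y k)
    rw [hJy, hJx, dotProduct_neg] at h
    linarith
  -- As both singular values are `t`, this element and the next centralize `H₀`. Applied to `x 1`,
  -- one order of their product gives `x 0` and the other gives zero.
  have hmem₁ : rootVec (x 0) (y 0) ∈ a := by
    refine mem_of_mulVec_commute ha hH₀ (rootVec_mem_pSpace (hJx 0) (hJy 0)) fun u => ?_
    simp only [rootVec_mulVec, dotProduct_mulVec_of_symm hsym, hJx, hJy, Matrix.mulVec_sub,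
      Matrix.mulVec_smul, Matrix.mulVec_neg, hHx, hHy, smul_dotProduct, smul_eq_mul]
    module
  have hmem₂ : rootVec (x 0) (y 1) + rootVec (x 1) (y 0) ∈ a := by
    refine mem_of_mulVec_commute ha hH₀ (Submodule.add_mem _ (rootVec_mem_pSpace (hJx 0) (hJy 1))
      (rootVec_mem_pSpace (hJx 1) (hJy 0))) fun u => ?_
    change ((rootVec (x 0) (y 1)).1 + (rootVec (x 1) (y 0)).1) *ᵥ _ =
      _ *ᵥ (((rootVec (x 0) (y 1)).1 + (rootVec (x 1) (y 0)).1) *ᵥ _)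
    simp only [Matrix.add_mulVec, rootVec_mulVec, dotProduct_mulVec_of_symm hsym, hJx, hJy,
      Matrix.mulVec_sub, Matrix.mulVec_add, Matrix.mulVec_smul, Matrix.mulVec_neg, hHx, hHy,
      smul_dotProduct, smul_eq_mul]
    module
  have h := congrArg (x 0 ⬝ᵥ ·) (commute_of_mem ha hmem₁ hmem₂ (x 1))
  change x 0 ⬝ᵥ (_ *ᵥ (((rootVec (x 0) (y 1)).1 + (rootVec (x 1) (y 0)).1) *ᵥ _)) =
    x 0 ⬝ᵥ (((rootVec (x 0) (y 1)).1 + (rootVec (x 1) (y 0)).1) *ᵥ _) at h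
  simp [Matrix.add_mulVec, rootVec_mulVec, hJx, hJy, hxy, hx, hy, dotProduct_comm (y _) (x _)] at h

theorem exists_adaptedFrame (hn : 1 ≤ n) (ha : IsMaximalAbelian a) {H₀ : a}
    (hH₀ : IsRegularElement a H₀) : ∃ e w f, IsAdaptedFrame a H₀ e w f := by
  have hsyma (H : a) := mem_pSpace_iff.1 (ha.prop.1 H.2)
  have hsym := hsyma H₀
  -- `H₀` exchanges the two eigenspaces of `J`; its square preserves them, and the `t i` are the
  -- squared singular values.
  obtain ⟨x, t, hx, hJx, hHHx, ht, hcx⟩ := exists_eigenvectors (n := n) (H := H₀.1.1 * H₀.1.1)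
    (by rw [Matrix.transpose_mul, hsym]) (fun u => by
      simp only [← Matrix.mulVec_mulVec, mulVec_J_of_symm hsym, Matrix.mulVec_neg, neg_neg])
  simp only [← Matrix.mulVec_mulVec] at hHHx
  have htx (i) : t i = H₀.1.1 *ᵥ x i ⬝ᵥ H₀.1.1 *ᵥ x i := by
    rw [← dotProduct_mulVec_of_symm hsym, hHHx, dotProduct_smul, hx, if_pos rfl, smul_eq_mul,
      mul_one]
  have ht1 : 0 < t 1 := by
    refine lt_of_le_of_ne (htx 1 ▸ vec_dotProduct_self_nonneg _) fun h => ?_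
    exact regular_mulVec_ne_zero hn ha hH₀ hx hJx hcx
      (dotProduct_self_eq_zero.1 ((htx 1).symm.trans h.symm))
  have htpos (i) : 0 < t i := by
    fin_cases i
    · exact ht1.trans_le ht
    · exact ht1
  set r : Fin 2 → ℝ := fun i => Real.sqrt (t i) with hr
  have hr0 (i) : 0 < r i := Real.sqrt_pos.2 (htpos i)
  have hr2 (i) : r i * r i = t i := Real.mul_self_sqrt (htpos i).le
  set y : Fin 2 → Vec n := fun i => (r i)⁻¹ • H₀.1.1 *ᵥ x i with hydef
  have hHx (i) : H₀.1.1 *ᵥ x i = r i • y i := by rw [hydef, smul_inv_smul₀ (hr0 i).ne']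
  have hHy (i) : H₀.1.1 *ᵥ y i = r i • x i := by
    rw [hydef, Matrix.mulVec_smul, hHHx, ← hr2, smul_smul, inv_mul_cancel_left₀ (hr0 i).ne']
  have hJy (i) : J n *ᵥ y i = -y i := by
    have h := mulVec_J_of_symm hsym (x i)
    rw [hJx] at h
    rw [hydef, Matrix.mulVec_smul, ← smul_neg, neg_eq_iff_eq_neg.1 h.symm]
  have hy (i j) : y i ⬝ᵥ y j = if i = j then 1 else 0 := by
    rw [hydef, smul_dotProduct, dotProduct_smul, ← dotProduct_mulVec_of_symm hsym, hHHx,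
      dotProduct_smul, hx]
    split_ifs with h
    · subst h
      have := (hr0 i).ne'
      rw [← hr2, smul_eq_mul, smul_eq_mul, smul_eq_mul]
      field_simp
    · simp
  have hlt : r 1 < r 0 := by
    refine lt_of_le_of_ne (Real.sqrt_le_sqrt ht) fun h => ?_
    have hri (i) : r i = r 0 := by
      fin_cases i
      · rfl
      · exact h
    exact regular_singular_value_ne ha hH₀ hx hJx hy hJy (fun i => by rw [hHx, hri])
      (fun i => by rw [hHy, hri])
  have hxy (i k) : x i ⬝ᵥ y k = 0 := by
    have h := dotProduct_J (x i) (y k)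
    rw [hJy, hJx, dotProduct_neg] at h
    linarith
  obtain ⟨b, hb, hbb, hJb, hcb⟩ := exists_extend_orthonormal (n := n)
    (Set.range (Fin.castAdd n)) (Fin.append y fun _ => 0)
    (by
      rintro _ ⟨i, rfl⟩ _ ⟨j, rfl⟩
      rw [Fin.append_left, Fin.append_left, hy]
      simp only [Fin.castAdd_inj])
    (by
      rintro _ ⟨i, rfl⟩
      rw [Fin.append_left, hJy])
  have hby (i : Fin 2) : b (Fin.castAdd n i) = y i := by rw [hb _ ⟨i, rfl⟩, Fin.append_left]
  set w : Fin n → Vec n := fun i => b (Fin.natAdd 2 i) with hw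
  have hyw (i j) : y i ⬝ᵥ w j = 0 := by
    rw [← hby, hbb, if_neg]
    simp only [Fin.ext_iff, Fin.val_castAdd, Fin.val_natAdd]
    omega
  have hxw (i k) : x i ⬝ᵥ w k = 0 := by
    have h := dotProduct_J (x i) (w k)
    rw [hJb, hJx, dotProduct_neg] at h
    linarith
  have hww (i j) : w i ⬝ᵥ w j = if i = j then 1 else 0 := by
    rw [hbb]
    simp only [Fin.natAdd_inj]
  -- `x i ± y i` are the eigenvectors of `H₀` for `± r i`; leaving them unnormalized gives square
  -- length two.
  set e : Fin 2 → Vec n := fun i => x i + y i with he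
  have hJe (i) : J n *ᵥ e i = x i - y i := by
    rw [he, Matrix.mulVec_add, hJx, hJy, sub_eq_add_neg]
  have hee (i j) : e i ⬝ᵥ e j = if i = j then 2 else 0 := by
    rw [he, add_dotProduct, dotProduct_add, dotProduct_add, hx, hy, hxy, dotProduct_comm, hxy]
    split_ifs <;> norm_num
  have heJe (i j) : e i ⬝ᵥ J n *ᵥ e j = 0 := by
    rw [hJe, he, add_dotProduct, dotProduct_sub, dotProduct_sub, hx, hy, hxy, dotProduct_comm (y i),
      hxy]
    ring
  have hew (i j) : e i ⬝ᵥ w j = 0 := by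
    rw [he, add_dotProduct, hxw, hyw, add_zero]
  -- Test the two `J`-parts `v ± J v` against the bases of the positive and the negative space.
  have hcomplete (v : Vec n) (h1 : ∀ i, e i ⬝ᵥ v = 0) (h2 : ∀ i, J n *ᵥ e i ⬝ᵥ v = 0)
      (h3 : ∀ i, w i ⬝ᵥ v = 0) : v = 0 := by
    simp only [hJe, sub_dotProduct] at h2
    simp only [he, add_dotProduct] at h1
    have hxv (i) : x i ⬝ᵥ v = 0 := by linarith [h1 i, h2 i]
    have hyv (i) : y i ⬝ᵥ v = 0 := by linarith [h1 i, h2 i]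
    have h4 : v + J n *ᵥ v = 0 := hcx _ (by rw [Matrix.mulVec_add, J_mulVec_J, add_comm v])
      fun i => by rw [dotProduct_add, dotProduct_J, hJx, hxv, add_zero]
    have h5 : v - J n *ᵥ v = 0 := by
      refine hcb _ (by rw [Matrix.mulVec_sub, J_mulVec_J, neg_sub]) fun i => ?_
      rw [dotProduct_sub, dotProduct_J, hJb, neg_dotProduct, sub_neg_eq_add]
      refine Fin.addCases (fun i => ?_) (fun i => ?_) i
      · rw [hby, hyv, add_zero]
      · have := h3 i
        rw [hw] at this
        rw [this, add_zero]
    have h6 : (2 : ℝ) • v = 0 := by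
      rw [two_smul]
      calc v + v = (v + J n *ᵥ v) + (v - J n *ᵥ v) := by abel
        _ = 0 := by rw [h4, h5, add_zero]
    exact (smul_eq_zero.1 h6).resolve_left two_ne_zero
  have hHe (i) : H₀.1.1 *ᵥ e i = r i • e i := by
    rw [he, Matrix.mulVec_add, hHx, hHy, smul_add, add_comm (r i • y i)]
  have hHJe (i) : H₀.1.1 *ᵥ (J n *ᵥ e i) = -r i • J n *ᵥ e i := by
    rw [mulVec_J_of_symm hsym, hHe, Matrix.mulVec_smul, neg_smul]
  have hHw (i) : H₀.1.1 *ᵥ w i = (0 : ℝ) • w i := by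
    rw [zero_smul]
    refine hcx _ ?_ fun j => ?_
    · rw [← neg_inj, ← mulVec_J_of_symm hsym, hJb, Matrix.mulVec_neg]
    · rw [dotProduct_mulVec_of_symm hsym, hHx, smul_dotProduct, hyw, smul_zero]
  -- `H` commutes with `H₀` and so preserves its eigenspaces. The eigenvalues `± r i` are simple,
  -- hence every `e i` is an eigenvector of all of `𝔞`.
  have horth (H : a) {u v : Vec n} {α β : ℝ} (hu : H₀.1.1 *ᵥ u = α • u) (hv : H₀.1.1 *ᵥ v = β • v)
      (hαβ : α ≠ β) : u ⬝ᵥ H.1.1 *ᵥ v = 0 := by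
    have h := dotProduct_mulVec_of_symm hsym u (H.1.1 *ᵥ v)
    rw [commute_of_mem ha H₀.2 H.2, hv, hu, Matrix.mulVec_smul, dotProduct_smul, smul_dotProduct,
      smul_eq_mul, smul_eq_mul] at h
    have h2 : (α - β) * (u ⬝ᵥ H.1.1 *ᵥ v) = 0 := by linarith
    exact (mul_eq_zero.1 h2).resolve_left (sub_ne_zero.2 hαβ)
  have hrne {i j : Fin 2} (h : i ≠ j) : r i ≠ r j := by
    fin_cases i <;> fin_cases j
    · exact absurd rfl h
    · exact hlt.ne'
    · exact hlt.ne
    · exact absurd rfl h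
  have hfe (H : a) (i) : H.1.1 *ᵥ e i = (e i ⬝ᵥ H.1.1 *ᵥ e i / 2) • e i := by
    rw [← sub_eq_zero]
    refine hcomplete _ (fun j => ?_) (fun j => ?_) fun j => ?_
    · rw [dotProduct_sub, dotProduct_smul, hee, smul_eq_mul]
      split_ifs with h
      · subst h
        ring
      · rw [horth H (hHe j) (hHe i) (hrne h)]
        ring
    · rw [dotProduct_sub, dotProduct_smul, dotProduct_comm _ (e i), heJe,
        horth H (hHJe j) (hHe i) (by linarith [hr0 i, hr0 j]), smul_zero, sub_zero]
    · rw [dotProduct_sub, dotProduct_smul, dotProduct_comm _ (e i), hew,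
        horth H (hHw j) (hHe i) (hr0 i).ne, smul_zero, sub_zero]
  -- `H (w i)` stays in the kernel of `H₀`, the span of the `w j`; but `H` reverses `J`-parity, so
  -- it is also orthogonal to every `w j`.
  have hfw (H : a) (i) : H.1.1 *ᵥ w i = 0 := by
    refine hcomplete _ (fun j => horth H (hHe j) (hHw i) (hr0 j).ne')
      (fun j => horth H (hHJe j) (hHw i) (by linarith [hr0 j])) fun j => ?_
    have h := dotProduct_J (w j) (H.1.1 *ᵥ w i)
    rw [hJb, ← neg_eq_iff_eq_neg.2 (mulVec_J_of_symm (hsyma H) (w i)), hJb, Matrix.mulVec_neg,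
      neg_neg, neg_dotProduct] at h
    linarith
  refine ⟨e, w, fun i => ⟨⟨fun H => e i ⬝ᵥ H.1.1 *ᵥ e i / 2, fun H H' => ?_⟩, fun c H => ?_⟩,
    hee, heJe, hew, hww, fun i => hJb _, hcomplete, hfe, hfw, ?_, ?_⟩
  · change e i ⬝ᵥ (H.1.1 + H'.1.1) *ᵥ e i / 2 = _
    rw [Matrix.add_mulVec, dotProduct_add, add_div]
  · change e i ⬝ᵥ (c • H.1.1) *ᵥ e i / 2 = c * (e i ⬝ᵥ H.1.1 *ᵥ e i / 2)
    rw [Matrix.smul_mulVec, dotProduct_smul, smul_eq_mul, mul_div_assoc]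
  · change 0 < e 1 ⬝ᵥ H₀.1.1 *ᵥ e 1 / 2
    rw [hHe, dotProduct_smul, hee, if_pos rfl, smul_eq_mul]
    linarith [hr0 1]
  · change e 1 ⬝ᵥ H₀.1.1 *ᵥ e 1 / 2 < e 0 ⬝ᵥ H₀.1.1 *ᵥ e 0 / 2
    rw [hHe, hHe, dotProduct_smul, dotProduct_smul, hee, hee, if_pos rfl, if_pos rfl, smul_eq_mul,
      smul_eq_mul]
    linarith

end Frame

/-! ### Recognizing a Heisenberg algebra from a basis -/

section HeisenbergBasis

variable {L : Type*} [LieRing L] [LieAlgebra ℝ L]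

theorem bilin_eq_sum_of_basis {ι : Type*} [Fintype ι] [DecidableEq ι] (b : Module.Basis ι ℝ L)
    (g : LinearMap.BilinForm ℝ L) (c : ι → ℝ) (h : ∀ i j, g (b i) (b j) = if i = j then c i else 0)
    (X Y : L) : g X Y = ∑ i, c i * (b.repr X i * b.repr Y i) := by
  have hg : g = ∑ i, c i • LinearMap.BilinForm.linMulLin (b.coord i) (b.coord i) := by
    refine LinearMap.ext_basis b b fun i j => ?_
    simp only [LinearMap.sum_apply, h, LinearMap.smul_apply, LinearMap.BilinForm.linMulLin_apply,
      Module.Basis.coord_apply, b.repr_self, Finsupp.single_apply, smul_eq_mul, mul_ite, mul_one,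
      mul_zero, Finset.sum_ite_eq, Finset.mem_univ, if_true]
    split_ifs with hij
    · rw [hij]
    · rfl
  conv_lhs => rw [hg]
  simp [LinearMap.sum_apply]

theorem isInnerProduct_of_basis {ι : Type*} [Fintype ι] [DecidableEq ι] (b : Module.Basis ι ℝ L)
    {g : LinearMap.BilinForm ℝ L} {c : ι → ℝ}
    (h : ∀ i j, g (b i) (b j) = if i = j then c i else 0) (hc : ∀ i, 0 < c i) :
    IsInnerProduct g := by
  refine ⟨fun X Y => ?_, fun X hX => ?_⟩
  · simp only [bilin_eq_sum_of_basis b g c h, mul_comm (b.repr X _)]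
  · rw [bilin_eq_sum_of_basis b g c h]
    obtain ⟨i, hi⟩ : ∃ i, b.repr X i ≠ 0 := by
      by_contra! h0
      exact hX (b.ext_elem fun i => by rw [h0 i, map_zero, Finsupp.zero_apply])
    exact Finset.sum_pos' (fun j _ => mul_nonneg (hc j).le (mul_self_nonneg _))
      ⟨i, Finset.mem_univ i, mul_pos (hc i) (mul_self_pos.2 hi)⟩

/-- An orthogonal basis `E k i`, `ζ` with `⁅E 0 i, E 1 i⁆ = ζ` and all other brackets zero makes `L`
a Heisenberg algebra. -/
theorem exists_isHeisenberg_of_basis (b : Module.Basis ((Fin 2 × Fin n) ⊕ Unit) ℝ L)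
    {g : LinearMap.BilinForm ℝ L} {κ l : ℝ} (hκ : 0 < κ) (hl : 0 < l)
    (hg : ∀ i j, g (b i) (b j) = if i = j then Sum.elim (fun _ => κ) (fun _ => l) i else 0)
    (hE : ∀ k m i j, ⁅b (.inl (k, i)), b (.inl (m, j))⁆ =
      if i = j then ((m : ℝ) - (k : ℝ)) • b (.inr ()) else 0)
    (hZ : ∀ i, ⁅b (.inr ()), b i⁆ = 0) :
    ∃ J η, IsHeisenberg g J η (b (.inr ())) κ l := by
  -- The rotation `E 0 i ↦ E 1 i`, `E 1 i ↦ -E 0 i`, `ζ ↦ 0`; the sign makes `⁅E k i, J (E k i)⁆ =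
  -- ζ` for both `k`.
  let J : L →ₗ[ℝ] L := b.constr ℝ (Sum.elim
    (fun p => (1 - 2 * (p.1 : ℝ)) • b (.inl (1 - p.1, p.2))) fun _ => 0)
  let η : L →ₗ[ℝ] ℝ := b.coord (.inr ())
  have hJE (k : Fin 2) (i : Fin n) :
      J (b (.inl (k, i))) = (1 - 2 * (k : ℝ)) • b (.inl (1 - k, i)) := b.constr_basis ℝ _ _
  have hJZ : J (b (.inr ())) = 0 := b.constr_basis ℝ _ _
  have hηE (p) : η (b (.inl p)) = 0 := by simp [η]
  have hηZ : η (b (.inr ())) = 1 := by simp [η]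
  have hZ' (i) : ⁅b i, b (.inr ())⁆ = 0 := by rw [← lie_skew, hZ, neg_zero]
  let B : L →ₗ[ℝ] L →ₗ[ℝ] L := LieModule.toEnd ℝ L L
  have hB (X Y : L) : B X Y = ⁅X, Y⁆ := rfl
  have hinj (k : Fin 2) : 1 - (1 - k) = k := by fin_cases k <;> rfl
  have h1 : B = B.compr₂ (η.smulRight (b (.inr ()))) := by
    refine LinearMap.ext_basis b b fun i j => ?_
    rw [LinearMap.compr₂_apply, LinearMap.smulRight_apply, hB]
    rcases i with ⟨k, i⟩ | ⟨⟩
    · rcases j with ⟨m, j⟩ | ⟨⟩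
      · rw [hE]
        split_ifs
        · rw [map_smul, hηZ, smul_eq_mul, mul_one]
        · rw [map_zero, zero_smul]
      · rw [hZ', map_zero, zero_smul]
    · rw [hZ, map_zero, zero_smul]
  have h2 : B (b (.inr ())) = 0 := b.ext fun i => hZ i
  have h3 : η ∘ₗ J = 0 := by
    refine b.ext fun i => ?_
    rcases i with ⟨k, i⟩ | ⟨⟩
    · rw [LinearMap.comp_apply, hJE, map_smul, hηE, smul_zero, LinearMap.zero_apply]
    · rw [LinearMap.comp_apply, hJZ, map_zero, LinearMap.zero_apply]
  have h4 : J ∘ₗ J = η.smulRight (b (.inr ())) - LinearMap.id := by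
    refine b.ext fun i => ?_
    rcases i with ⟨k, i⟩ | ⟨⟩
    · rw [LinearMap.comp_apply, hJE, map_smul, hJE, hinj, LinearMap.sub_apply,
        LinearMap.smulRight_apply, hηE, zero_smul, LinearMap.id_apply, smul_smul]
      fin_cases k <;> norm_num
    · rw [LinearMap.comp_apply, hJZ, map_zero, LinearMap.sub_apply,
        LinearMap.smulRight_apply, hηZ, one_smul, LinearMap.id_apply, sub_self]
  have h5 : LinearMap.trace ℝ L J = 0 := by
    rw [LinearMap.trace_eq_matrix_trace ℝ b]
    refine Finset.sum_eq_zero fun i _ => ?_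
    rw [Matrix.diag_apply, LinearMap.toMatrix_apply]
    rcases i with ⟨k, i⟩ | ⟨⟩
    · rw [hJE, map_smul, b.repr_self, Finsupp.smul_apply, Finsupp.single_apply, if_neg, smul_zero]
      fin_cases k <;> simp
    · rw [hJZ, map_zero, Finsupp.zero_apply]
  have h6 : g = κ • (B.compr₂ η).compl₂ J + l • LinearMap.BilinForm.linMulLin η η := by
    refine LinearMap.ext_basis b b fun i j => ?_
    simp only [LinearMap.add_apply, LinearMap.smul_apply, LinearMap.compl₂_apply,
      LinearMap.compr₂_apply, LinearMap.BilinForm.linMulLin_apply, hB, hg]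
    rcases i with ⟨k, i⟩ | ⟨⟩
    · rcases j with ⟨m, j⟩ | ⟨⟩
      · rw [hJE, hηE, zero_mul, smul_zero, add_zero, lie_smul, hE]
        by_cases hij : i = j
        · subst hij
          rw [if_pos rfl, map_smul, map_smul, hηZ]
          fin_cases k <;> fin_cases m <;> norm_num
        · simp [hij]
      · simp [hJZ, hηE]
    · rcases j with ⟨m, j⟩ | ⟨⟩
      · simp [hJE, hZ, hηE]
      · simp [hJZ, hηZ]
  refine ⟨J, η, ⟨fun X Y => ?_, fun Y => ?_, hηZ, hJZ, fun X => ?_, fun X => ?_, h5,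
    fun X Y => ?_, isInnerProduct_of_basis b hg ?_, hκ.ne', hl.ne'⟩⟩
  · exact LinearMap.congr_fun₂ h1 X Y
  · exact LinearMap.congr_fun h2 Y
  · exact LinearMap.congr_fun h3 X
  · exact LinearMap.congr_fun h4 X
  · exact LinearMap.congr_fun₂ h6 X Y
  · rintro (i | i)
    · exact hκ
    · exact hl

end HeisenbergBasis

/-! ### The Heisenberg algebra spanned by the root vectors -/

section FrameAlgebra

/-- The root vectors `E k i` and `ζ` of a frame. -/
def frameVec (e : Fin 2 → Vec n) (w : Fin n → Vec n) : (Fin 2 × Fin n) ⊕ Unit → so2 n :=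
  Sum.elim (fun p => rootVec (e p.1) (w p.2)) fun _ => rootVec (e 0) (J n *ᵥ e 1)

namespace IsAdaptedFrame

variable {a : Submodule ℝ (so2 n)} {H₀ : a} {e : Fin 2 → Vec n} {w : Fin n → Vec n}
  {f : Fin 2 → Module.Dual ℝ a}

theorem w_e (h : IsAdaptedFrame a H₀ e w f) (i j) : w i ⬝ᵥ e j = 0 := by
  rw [dotProduct_comm, h.e_w]

theorem Je_e (h : IsAdaptedFrame a H₀ e w f) (i j) : J n *ᵥ e i ⬝ᵥ e j = 0 := by
  rw [dotProduct_comm, h.e_Je]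

theorem Je_w (h : IsAdaptedFrame a H₀ e w f) (i j) : J n *ᵥ e i ⬝ᵥ w j = 0 := by
  rw [← dotProduct_J, h.J_w, dotProduct_neg, h.e_w, neg_zero]

theorem w_Je (h : IsAdaptedFrame a H₀ e w f) (i j) : w i ⬝ᵥ J n *ᵥ e j = 0 := by
  rw [dotProduct_comm, h.Je_w]

theorem Je_Je (h : IsAdaptedFrame a H₀ e w f) (i j) :
    J n *ᵥ e i ⬝ᵥ J n *ᵥ e j = if i = j then 2 else 0 := by
  rw [← dotProduct_J, J_mulVec_J, h.e_e]

theorem frameVec_inl (h : IsAdaptedFrame a H₀ e w f) (p : Fin 2 × Fin n) :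
    (frameVec e w (.inl p)).1 = Matrix.vecMulVec (e p.1) (w p.2) +
      Matrix.vecMulVec (w p.2) (J n *ᵥ e p.1) := by
  change (rootVec _ _).1 = _
  rw [coe_rootVec, h.J_w, Matrix.neg_vecMulVec, sub_neg_eq_add]

theorem frameVec_inr (e : Fin 2 → Vec n) (w : Fin n → Vec n) (x : Unit) :
    (frameVec e w (.inr x)).1 = Matrix.vecMulVec (e 0) (J n *ᵥ e 1) -
      Matrix.vecMulVec (e 1) (J n *ᵥ e 0) := by
  change (rootVec _ _).1 = _
  rw [coe_rootVec, J_mulVec_J]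

/-- Among the four products of dyads only the contraction of `w` with `w` survives. -/
theorem frameVec_inl_mul_inl (h : IsAdaptedFrame a H₀ e w f) (p q : Fin 2 × Fin n) :
    (frameVec e w (.inl p)).1 * (frameVec e w (.inl q)).1 =
      if p.2 = q.2 then Matrix.vecMulVec (e p.1) (J n *ᵥ e q.1) else 0 := by
  simp only [h.frameVec_inl, Matrix.add_mul, Matrix.mul_add, Matrix.vecMulVec_mul_vecMulVec,
    h.w_e, h.w_w, h.Je_e, h.Je_w, zero_smul, Matrix.vecMulVec_zero, ite_smul, one_smul]
  split_ifs <;> simp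

theorem frameVec_inr_mul (h : IsAdaptedFrame a H₀ e w f) (x) (i) :
    (frameVec e w (.inr x)).1 * (frameVec e w i).1 = 0 := by
  rcases i with p | y
  · simp [h.frameVec_inl, frameVec_inr, Matrix.sub_mul, Matrix.mul_add,
      Matrix.vecMulVec_mul_vecMulVec, h.Je_e, h.Je_w]
  · simp [frameVec_inr, Matrix.sub_mul, Matrix.mul_sub, Matrix.vecMulVec_mul_vecMulVec, h.Je_e]

theorem frameVec_mul_inr (h : IsAdaptedFrame a H₀ e w f) (x) (i) :
    (frameVec e w i).1 * (frameVec e w (.inr x)).1 = 0 := by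
  rcases i with p | y
  · simp [h.frameVec_inl, frameVec_inr, Matrix.add_mul, Matrix.mul_sub,
      Matrix.vecMulVec_mul_vecMulVec, h.Je_e, h.w_e]
  · exact h.frameVec_inr_mul y _

/-- A product of two root vectors is zero or a dyad of some `e k` and some `J (e m)`, and the
covector `J (e m)` annihilates all `e` and `w`. -/
theorem frameVec_mul_mul (h : IsAdaptedFrame a H₀ e w f) (i j k) :
    (frameVec e w i).1 * (frameVec e w j).1 * (frameVec e w k).1 = 0 := by
  rcases i with p | x
  · rcases j with q | x
    · rcases k with r | x
      · rw [h.frameVec_inl_mul_inl]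
        split_ifs
        · simp [h.frameVec_inl, Matrix.mul_add, Matrix.vecMulVec_mul_vecMulVec, h.Je_e, h.Je_w]
        · rw [Matrix.zero_mul]
      · rw [Matrix.mul_assoc, h.frameVec_mul_inr, Matrix.mul_zero]
    · rw [h.frameVec_mul_inr, Matrix.zero_mul]
  · rw [h.frameVec_inr_mul, Matrix.zero_mul]

theorem lie_frameVec_inl (h : IsAdaptedFrame a H₀ e w f) (k m : Fin 2) (i j : Fin n) :
    ⁅frameVec e w (.inl (k, i)), frameVec e w (.inl (m, j))⁆ =
      if i = j then ((m : ℝ) - (k : ℝ)) • frameVec e w (.inr ()) else 0 := by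
  refine Subtype.ext ?_
  change (frameVec e w (.inl (k, i))).1 * (frameVec e w (.inl (m, j))).1 -
    (frameVec e w (.inl (m, j))).1 * (frameVec e w (.inl (k, i))).1 = _
  rw [h.frameVec_inl_mul_inl, h.frameVec_inl_mul_inl]
  by_cases hij : i = j
  · subst hij
    rw [if_pos rfl, if_pos rfl, if_pos rfl]
    change _ = ((m : ℝ) - (k : ℝ)) • (frameVec e w (.inr ())).1
    rw [frameVec_inr]
    fin_cases k <;> fin_cases m <;> simp
  · simp [hij, Ne.symm hij]

theorem lie_frameVec_inr (h : IsAdaptedFrame a H₀ e w f) (i) :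
    ⁅frameVec e w (.inr ()), frameVec e w i⁆ = 0 := by
  refine Subtype.ext ?_
  change (frameVec e w (.inr ())).1 * (frameVec e w i).1 -
    (frameVec e w i).1 * (frameVec e w (.inr ())).1 = 0
  rw [h.frameVec_inr_mul, h.frameVec_mul_inr, sub_zero]

/-- The traces of `X Y` vanish, so the metric is `(n + 2) / 2` times the Frobenius product; the
squared norms are `4` and `8`, because `e k` has square length two. -/
theorem projMetric_frameVec (h : IsAdaptedFrame a H₀ e w f) (i j) :
    projMetric n (frameVec e w i) (frameVec e w j) =
      if i = j then Sum.elim (fun _ => 2 * (n + 2 : ℝ)) (fun _ => 4 * (n + 2 : ℝ)) i else 0 := by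
  rw [projMetric_apply]
  rcases i with ⟨k, i⟩ | x
  · rcases j with ⟨m, j⟩ | y
    · have h1 : ((frameVec e w (.inl (k, i))).1 * (frameVec e w (.inl (m, j))).1).trace = 0 := by
        rw [h.frameVec_inl_mul_inl]
        split_ifs
        · rw [Matrix.trace_vecMulVec, h.e_Je]
        · exact Matrix.trace_zero _ _
      rw [h1]
      simp only [h.frameVec_inl, Matrix.transpose_add, Matrix.transpose_vecMulVec, Matrix.add_mul,
        Matrix.mul_add, Matrix.vecMulVec_mul_vecMulVec, h.w_w, h.w_Je, h.Je_w, h.Je_Je,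
        Matrix.vecMulVec_smul, Matrix.trace_add, Matrix.trace_smul, Matrix.trace_vecMulVec,
        h.e_e, Sum.inl.injEq, Prod.mk.injEq, Sum.elim_inl, smul_eq_mul]
      by_cases hk : k = m <;> by_cases hi : i = j <;> simp [hk, hi]
      ring
    · rw [h.frameVec_mul_inr]
      simp [h.frameVec_inl, frameVec_inr, Matrix.transpose_vecMulVec, Matrix.add_mul,
        Matrix.mul_sub, Matrix.vecMulVec_mul_vecMulVec, h.w_Je, Matrix.trace_vecMulVec,
        Matrix.vecMulVec_smul, h.w_e]
  · rcases j with ⟨m, j⟩ | y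
    · rw [h.frameVec_inr_mul]
      simp [h.frameVec_inl, frameVec_inr, Matrix.transpose_vecMulVec, Matrix.sub_mul,
        Matrix.mul_add, Matrix.vecMulVec_mul_vecMulVec, h.Je_w, Matrix.trace_vecMulVec,
        Matrix.vecMulVec_smul, h.e_w]
    · rw [h.frameVec_inr_mul]
      simp [frameVec_inr, Matrix.transpose_vecMulVec, Matrix.sub_mul,
        Matrix.mul_sub, Matrix.vecMulVec_mul_vecMulVec, h.Je_Je, Matrix.trace_vecMulVec,
        Matrix.vecMulVec_smul, h.e_e]
      ring

/-- The Heisenberg subalgebra of `𝔫`, the sum of the root spaces of all positive roots except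
`f 0 - f 1`. -/
def heisenberg (h : IsAdaptedFrame a H₀ e w f) : LieSubalgebra ℝ (so2 n) where
  toSubmodule := Submodule.span ℝ (Set.range (frameVec e w))
  lie_mem' {X Y} hX hY := by
    simp only [AddSubsemigroup.mem_carrier, AddSubmonoid.mem_toSubsemigroup,
      Submodule.mem_toAddSubmonoid] at hX hY ⊢
    have hb : ∀ i j, ⁅frameVec e w i, frameVec e w j⁆ ∈
        Submodule.span ℝ (Set.range (frameVec e w)) := by
      intro i j
      rcases i with ⟨k, i⟩ | ⟨⟩
      · rcases j with ⟨m, j⟩ | ⟨⟩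
        · rw [h.lie_frameVec_inl]
          split_ifs
          · exact Submodule.smul_mem _ _ (Submodule.subset_span ⟨_, rfl⟩)
          · exact Submodule.zero_mem _
        · rw [← lie_skew, h.lie_frameVec_inr, neg_zero]
          exact Submodule.zero_mem _
      · rw [h.lie_frameVec_inr]
        exact Submodule.zero_mem _
    induction hX using Submodule.span_induction with
    | zero => rw [zero_lie]; exact Submodule.zero_mem _
    | add X X' _ _ h h' => rw [add_lie]; exact Submodule.add_mem _ h h'
    | smul r X _ h => rw [smul_lie]; exact Submodule.smul_mem _ _ h
    | mem X hX =>
      obtain ⟨i, rfl⟩ := hX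
      induction hY using Submodule.span_induction with
      | zero => rw [lie_zero]; exact Submodule.zero_mem _
      | add Y Y' _ _ h h' => rw [lie_add]; exact Submodule.add_mem _ h h'
      | smul r Y _ h => rw [lie_smul]; exact Submodule.smul_mem _ _ h
      | mem Y hY =>
        obtain ⟨j, rfl⟩ := hY
        exact hb i j

theorem mem_heisenberg (h : IsAdaptedFrame a H₀ e w f) {X : so2 n} :
    X ∈ h.heisenberg ↔ X ∈ Submodule.span ℝ (Set.range (frameVec e w)) := Iff.rfl

theorem frameVec_mem (h : IsAdaptedFrame a H₀ e w f) (i) : frameVec e w i ∈ h.heisenberg :=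
  Submodule.subset_span ⟨i, rfl⟩

theorem isThreeStepNil (h : IsAdaptedFrame a H₀ e w f) : IsThreeStepNil h.heisenberg := by
  intro X hX Y hY Z hZ
  rw [mem_heisenberg] at hX hY hZ
  induction hX using Submodule.span_induction with
  | zero => exact (congrArg (· * Z.1) (Matrix.zero_mul Y.1)).trans (Matrix.zero_mul _)
  | add X X' _ _ h h' =>
    change (X.1 + X'.1) * _ * _ = 0
    rw [Matrix.add_mul, Matrix.add_mul, h, h', add_zero]
  | smul r X _ h =>
    change (r • X.1) * _ * _ = 0
    rw [Matrix.smul_mul, Matrix.smul_mul, h, smul_zero]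
  | mem X hX =>
    obtain ⟨i, rfl⟩ := hX
    induction hY using Submodule.span_induction with
    | zero => exact (congrArg (· * Z.1) (Matrix.mul_zero _)).trans (Matrix.zero_mul _)
    | add Y Y' _ _ h h' =>
      change _ * (Y.1 + Y'.1) * _ = 0
      rw [Matrix.mul_add, Matrix.add_mul, h, h', add_zero]
    | smul r Y _ h =>
      change _ * (r • Y.1) * _ = 0
      rw [Matrix.mul_smul, Matrix.smul_mul, h, smul_zero]
    | mem Y hY =>
      obtain ⟨j, rfl⟩ := hY
      induction hZ using Submodule.span_induction with
      | zero => exact Matrix.mul_zero _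
      | add Z Z' _ _ h h' =>
        change _ * (Z.1 + Z'.1) = 0
        rw [Matrix.mul_add, h, h', add_zero]
      | smul r Z _ h =>
        change _ * (r • Z.1) = 0
        rw [Matrix.mul_smul, h, smul_zero]
      | mem Z hZ =>
        obtain ⟨k, rfl⟩ := hZ
        exact h.frameVec_mul_mul i j k

theorem linearIndependent_frameVec (h : IsAdaptedFrame a H₀ e w f) :
    LinearIndependent ℝ (frameVec e w) := by
  refine LinearMap.linearIndependent_of_isOrthoᵢ (B := projMetric n) ?_ fun i => ?_
  · rw [LinearMap.isOrthoᵢ_def]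
    intro i j hij
    rw [h.projMetric_frameVec, if_neg hij]
  · rw [h.projMetric_frameVec, if_pos rfl]
    rcases i with i | i
    · exact (by positivity : (0 : ℝ) < 2 * (n + 2 : ℝ)).ne'
    · exact (by positivity : (0 : ℝ) < 4 * (n + 2 : ℝ)).ne'

theorem exists_basis (h : IsAdaptedFrame a H₀ e w f) :
    ∃ b : Module.Basis ((Fin 2 × Fin n) ⊕ Unit) ℝ h.heisenberg,
      ∀ i, (b i : so2 n) = frameVec e w i :=
  ⟨Module.Basis.span h.linearIndependent_frameVec, fun i =>
    congrArg Subtype.val (Module.Basis.span_apply h.linearIndependent_frameVec i)⟩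

theorem finrank_heisenberg (h : IsAdaptedFrame a H₀ e w f) :
    Module.finrank ℝ h.heisenberg = 2 * n + 1 := by
  obtain ⟨b, -⟩ := h.exists_basis
  rw [Module.finrank_eq_card_basis b]
  simp

theorem exists_isHeisenberg (h : IsAdaptedFrame a H₀ e w f) :
    ∃ J η ζ κ l, IsHeisenberg (inducedMetric h.heisenberg) J η ζ κ l := by
  obtain ⟨b, hb⟩ := h.exists_basis
  obtain ⟨J, η, hH⟩ := exists_isHeisenberg_of_basis (g := inducedMetric h.heisenberg) b
    (κ := 2 * (n + 2 : ℝ)) (l := 4 * (n + 2 : ℝ)) (by positivity) (by positivity)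
    (fun i j => by rw [inducedMetric_apply, hb, hb, h.projMetric_frameVec])
    (fun k m i j => Subtype.ext (by
      rw [LieSubalgebra.coe_bracket, hb, hb, h.lie_frameVec_inl]
      split_ifs
      · rw [← hb]
        rfl
      · rfl))
    (fun i => Subtype.ext (by
      rw [LieSubalgebra.coe_bracket, hb, hb, h.lie_frameVec_inr]
      rfl))
  exact ⟨J, η, _, _, _, hH⟩

end IsAdaptedFrame

end FrameAlgebra

/-! ### The dimension of `𝔫`, and noncommutativity of the group -/

section Nilradical

variable {a : Submodule ℝ (so2 n)} {H₀ : a}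

theorem mem_nilradical_of_pos {μ : Module.Dual ℝ a} (hμ : 0 < μ H₀) {X : so2 n}
    (hX : X ∈ rootSpace a μ) : X ∈ nilradical a H₀ := by
  by_cases h0 : X = 0
  · rw [h0]
    exact (nilradical a H₀).zero_mem
  · have hmem : μ ∈ positiveRoots a H₀ := by
      refine ⟨⟨fun h => ?_, fun h => h0 ?_⟩, hμ⟩
      · rw [h] at hμ
        simp at hμ
      · rwa [h, Submodule.mem_bot] at hX
    exact Submodule.mem_iSup_of_mem (p := fun μ : positiveRoots a H₀ => rootSpace a μ) ⟨μ, hmem⟩ hX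

/-- Elements of `𝔫` strictly raise the eigenvalues of `H₀`. -/
theorem dotProduct_nilradical_eq_zero (ha : a ≤ pSpace n) {u v : Vec n} {α β : ℝ}
    (hu : H₀.1.1 *ᵥ u = α • u) (hv : H₀.1.1 *ᵥ v = β • v) (hαβ : α ≤ β) {X : so2 n}
    (hX : X ∈ nilradical a H₀) : u ⬝ᵥ X.1 *ᵥ v = 0 := by
  have hX' : X ∈ ⨆ μ : positiveRoots a H₀, rootSpace a μ := hX
  clear hX
  induction hX' using Submodule.iSup_induction' with
  | zero =>
    change u ⬝ᵥ (0 : Matrix _ _ ℝ) *ᵥ v = 0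
    rw [Matrix.zero_mulVec, dotProduct_zero]
  | add X X' _ _ h h' =>
    change u ⬝ᵥ (X.1 + X'.1) *ᵥ v = 0
    rw [Matrix.add_mulVec, dotProduct_add, h, h', add_zero]
  | mem μ X hXμ =>
    have h1 := congrArg (fun A : so2 n => u ⬝ᵥ A.1 *ᵥ v) (hXμ H₀)
    change u ⬝ᵥ (H₀.1.1 * X.1 - X.1 * H₀.1.1) *ᵥ v = u ⬝ᵥ (μ.1 H₀ • X.1) *ᵥ v at h1
    rw [Matrix.sub_mulVec, ← Matrix.mulVec_mulVec, ← Matrix.mulVec_mulVec, dotProduct_sub,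
      dotProduct_mulVec_of_symm (mem_pSpace_iff.1 (ha H₀.2)), hu, hv, Matrix.mulVec_smul,
      Matrix.smul_mulVec, smul_dotProduct, dotProduct_smul, dotProduct_smul, smul_eq_mul,
      smul_eq_mul, smul_eq_mul] at h1
    have h2 : (α - β - μ.1 H₀) * (u ⬝ᵥ X.1 *ᵥ v) = 0 := by linarith
    have h3 := μ.2.2
    exact (mul_eq_zero.1 h2).resolve_left (by linarith)

/-- `J X` is skew-symmetric. -/
theorem J_dotProduct_mulVec (X : so2 n) (u v : Vec n) :
    J n *ᵥ u ⬝ᵥ X.1 *ᵥ v = -(J n *ᵥ v ⬝ᵥ X.1 *ᵥ u) := by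
  have h : J n *ᵥ (X.1 *ᵥ v) = -(X.1ᵀ *ᵥ (J n *ᵥ v)) := by
    rw [Matrix.mulVec_mulVec, Matrix.mulVec_mulVec, transpose_mul_J, Matrix.neg_mulVec, neg_neg]
  rw [← dotProduct_J, h, dotProduct_neg, Matrix.mulVec_transpose, dotProduct_comm,
    ← Matrix.dotProduct_mulVec]

namespace IsAdaptedFrame

variable {e : Fin 2 → Vec n} {w : Fin n → Vec n} {f : Fin 2 → Module.Dual ℝ a}

theorem pos' (h : IsAdaptedFrame a H₀ e w f) (k : Fin 2) : 0 < f k H₀ := by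
  fin_cases k
  · exact h.pos.trans h.lt
  · exact h.pos

theorem mulVec_Je (h : IsAdaptedFrame a H₀ e w f) (ha : a ≤ pSpace n) (H : a) (k : Fin 2) :
    H.1.1 *ᵥ (J n *ᵥ e k) = (-f k H) • J n *ᵥ e k := by
  rw [mulVec_J_of_symm (mem_pSpace_iff.1 (ha H.2)), h.mulVec_e, Matrix.mulVec_smul, neg_smul]

theorem frameVec_mem_nilradical (h : IsAdaptedFrame a H₀ e w f) (ha : a ≤ pSpace n) (i) :
    frameVec e w i ∈ nilradical a H₀ := by
  rcases i with ⟨k, i⟩ | x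
  · refine mem_nilradical_of_pos (μ := f k - 0) ?_ (rootVec_mem_rootSpace ha
      (fun H => h.mulVec_e H k) fun H => ?_)
    · rw [sub_zero]
      exact h.pos' k
    · rw [h.mulVec_w, LinearMap.zero_apply, zero_smul]
  · refine mem_nilradical_of_pos (μ := f 0 - -f 1) ?_ (rootVec_mem_rootSpace ha
      (fun H => h.mulVec_e H 0) fun H => h.mulVec_Je ha H 1)
    rw [sub_neg_eq_add]
    exact add_pos (h.pos' 0) (h.pos' 1)

theorem heisenberg_le (h : IsAdaptedFrame a H₀ e w f) (ha : a ≤ pSpace n) :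
    h.heisenberg ≤ nilradical a H₀ := by
  have h1 : Submodule.span ℝ (Set.range (frameVec e w)) ≤ (nilradical a H₀).toSubmodule := by
    rw [Submodule.span_le]
    rintro _ ⟨i, rfl⟩
    exact h.frameVec_mem_nilradical ha i
  exact h1

theorem rootVec_mem_nilradical (h : IsAdaptedFrame a H₀ e w f) (ha : a ≤ pSpace n) :
    rootVec (e 0) (e 1) ∈ nilradical a H₀ := by
  refine mem_nilradical_of_pos (μ := f 0 - f 1) ?_ (rootVec_mem_rootSpace ha
    (fun H => h.mulVec_e H 0) fun H => h.mulVec_e H 1)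
  rw [LinearMap.sub_apply]
  exact sub_pos.2 h.lt

/-- The coefficient `⟨e 0, X (e 1)⟩` vanishes on the whole Heisenberg algebra and is `4` on this
root vector. -/
theorem rootVec_notMem_heisenberg (h : IsAdaptedFrame a H₀ e w f) :
    rootVec (e 0) (e 1) ∉ h.heisenberg := by
  intro hmem
  have hall : ∀ X ∈ h.heisenberg, e 0 ⬝ᵥ X.1 *ᵥ e 1 = 0 := by
    intro X hX
    rw [mem_heisenberg] at hX
    induction hX using Submodule.span_induction with
    | zero =>
      change _ ⬝ᵥ (0 : Matrix _ _ ℝ) *ᵥ _ = 0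
      rw [Matrix.zero_mulVec, dotProduct_zero]
    | add X X' _ _ h h' =>
      change _ ⬝ᵥ (X.1 + X'.1) *ᵥ _ = 0
      rw [Matrix.add_mulVec, dotProduct_add, h, h', add_zero]
    | smul r X _ h =>
      change _ ⬝ᵥ (r • X.1) *ᵥ _ = 0
      rw [Matrix.smul_mulVec, dotProduct_smul, h, smul_zero]
    | mem X hX =>
      obtain ⟨i, rfl⟩ := hX
      rcases i with i | x
      · simp [h.frameVec_inl, Matrix.add_mulVec, Matrix.vecMulVec_mulVec, h.w_e, h.Je_e]
      · simp [frameVec_inr, Matrix.sub_mulVec, Matrix.vecMulVec_mulVec, h.Je_e]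
  have h1 := hall _ hmem
  rw [rootVec_mulVec, dotProduct_sub, dotProduct_smul, dotProduct_smul, h.e_e, h.e_e, h.Je_e] at h1
  norm_num at h1

/-- The coordinates of elements of `𝔫` with respect to the root vectors. -/
def coordinates (a : Submodule ℝ (so2 n)) (H₀ : a) (e : Fin 2 → Vec n) (w : Fin n → Vec n) :
    nilradical a H₀ →ₗ[ℝ] (Fin 2 × Fin n → ℝ) × ℝ × ℝ where
  toFun X := (fun p => e p.1 ⬝ᵥ X.1.1 *ᵥ w p.2, e 0 ⬝ᵥ X.1.1 *ᵥ e 1,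
    e 0 ⬝ᵥ X.1.1 *ᵥ (J n *ᵥ e 1))
  map_add' X Y := by
    have h (u v : Vec n) : u ⬝ᵥ (X + Y).1.1 *ᵥ v = u ⬝ᵥ X.1.1 *ᵥ v + u ⬝ᵥ Y.1.1 *ᵥ v := by
      rw [← dotProduct_add, ← Matrix.add_mulVec]
      rfl
    simp only [h]
    rfl
  map_smul' r X := by
    have h (u v : Vec n) : u ⬝ᵥ (r • X).1.1 *ᵥ v = r * (u ⬝ᵥ X.1.1 *ᵥ v) := by
      rw [← smul_eq_mul, ← dotProduct_smul, ← Matrix.smul_mulVec]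
      rfl
    simp only [h]
    rfl

theorem eq_zero_of_mulVec (h : IsAdaptedFrame a H₀ e w f)
    {A : Matrix (Fin 2 ⊕ Fin (2 + n)) (Fin 2 ⊕ Fin (2 + n)) ℝ} (he : ∀ k, A *ᵥ e k = 0)
    (hJe : ∀ k, A *ᵥ (J n *ᵥ e k) = 0) (hw : ∀ i, A *ᵥ w i = 0) : A = 0 := by
  funext r
  refine h.complete (A r) (fun k => ?_) (fun k => ?_) fun i => ?_
  · rw [dotProduct_comm]
    exact congrFun (he k) r
  · rw [dotProduct_comm]
    exact congrFun (hJe k) r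
  · rw [dotProduct_comm]
    exact congrFun (hw i) r

/-- Elements of `𝔫` strictly raise `H₀`-eigenvalues, which kills the entries on and below the
diagonal. Skewness of `J X` determines the rest: it kills the pairings of `e k` with `J (e k)` and
relates the remaining entries to the given coordinates. -/
theorem coordinates_injective (h : IsAdaptedFrame a H₀ e w f) (ha : a ≤ pSpace n) :
    Function.Injective (coordinates a H₀ e w) := by
  rw [← LinearMap.ker_eq_bot, LinearMap.ker_eq_bot']
  intro X hX
  have h1 (k i) : e k ⬝ᵥ X.1.1 *ᵥ w i = 0 := congrFun (congrArg Prod.fst hX) (k, i)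
  have h2 : e 0 ⬝ᵥ X.1.1 *ᵥ e 1 = 0 := congrArg (fun p => p.2.1) hX
  have h3 : e 0 ⬝ᵥ X.1.1 *ᵥ (J n *ᵥ e 1) = 0 := congrArg (fun p => p.2.2) hX
  have hz {u v : Vec n} {α β : ℝ} (hu : H₀.1.1 *ᵥ u = α • u) (hv : H₀.1.1 *ᵥ v = β • v)
    (hαβ : α ≤ β) : u ⬝ᵥ X.1.1 *ᵥ v = 0 := dotProduct_nilradical_eq_zero ha hu hv hαβ X.2
  have he := h.mulVec_e H₀
  have hd := h.mulVec_Je ha H₀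
  have hw (i) : H₀.1.1 *ᵥ w i = (0 : ℝ) • w i := by rw [h.mulVec_w, zero_smul]
  have hp := h.pos'
  have hJJ (u v : Vec n) : u ⬝ᵥ X.1.1 *ᵥ (J n *ᵥ v) = -(v ⬝ᵥ X.1.1 *ᵥ (J n *ᵥ u)) := by
    have := J_dotProduct_mulVec X.1 (J n *ᵥ u) (J n *ᵥ v)
    rwa [J_mulVec_J, J_mulVec_J] at this
  have hee (k l) : e k ⬝ᵥ X.1.1 *ᵥ e l = 0 := by
    fin_cases k <;> fin_cases l
    · exact hz (he 0) (he 0) le_rfl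
    · exact h2
    · exact hz (he 1) (he 0) h.lt.le
    · exact hz (he 1) (he 1) le_rfl
  have hed (k l) : e k ⬝ᵥ X.1.1 *ᵥ (J n *ᵥ e l) = 0 := by
    fin_cases k <;> fin_cases l
    · exact self_eq_neg.1 (hJJ (e 0) (e 0))
    · exact h3
    · exact (hJJ (e 1) (e 0)).trans (neg_eq_zero.2 h3)
    · exact self_eq_neg.1 (hJJ (e 1) (e 1))
  refine Subtype.ext (Subtype.ext (h.eq_zero_of_mulVec (fun l => ?_) (fun l => ?_) fun j => ?_))
  · exact h.complete _ (fun k => hee k l)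
      (fun k => hz (hd k) (he l) (by linarith [hp k, hp l])) fun i => hz (hw i) (he l) (hp l).le
  · refine h.complete _ (fun k => hed k l) (fun k => ?_) fun i => ?_
    · rw [J_dotProduct_mulVec, J_mulVec_J, hee, neg_zero]
    · rw [hJJ, h.J_w, Matrix.mulVec_neg, dotProduct_neg, h1, neg_zero, neg_zero]
  · exact h.complete _ (fun k => h1 k j) (fun k => hz (hd k) (hw j) (by linarith [hp k]))
      fun i => hz (hw i) (hw j) le_rfl

/-- Only two bounds are needed, not a description of each root space: the coordinates give at most
`2 n + 2`, and the strict inclusion of the Heisenberg algebra gives at least that. -/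
theorem finrank_nilradical (h : IsAdaptedFrame a H₀ e w f) (ha : a ≤ pSpace n) :
    Module.finrank ℝ (nilradical a H₀) = 2 * n + 2 := by
  refine le_antisymm ?_ ?_
  · refine (LinearMap.finrank_le_finrank_of_injective (h.coordinates_injective ha)).trans ?_
    simp
  · have hlt : h.heisenberg.toSubmodule < (nilradical a H₀).toSubmodule := by
      refine lt_of_le_of_ne (h.heisenberg_le ha) fun heq => h.rootVec_notMem_heisenberg ?_
      have := h.rootVec_mem_nilradical ha
      change _ ∈ h.heisenberg.toSubmodule
      rw [heq]
      exact this
    have h1 := Submodule.finrank_lt_finrank_of_lt hlt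
    have h2 : Module.finrank ℝ h.heisenberg.toSubmodule = 2 * n + 1 := h.finrank_heisenberg
    have h3 : Module.finrank ℝ (nilradical a H₀).toSubmodule =
      Module.finrank ℝ (nilradical a H₀) := rfl
    omega

/-- By the product formula, commuting exponentials would force `⁅X, Y⁆ = 0`, whereas this bracket is
the central root vector. The index `0` exists because `n ≥ 1`. -/
theorem exists_not_commute (h : IsAdaptedFrame a H₀ e w f) (hn : 1 ≤ n) :
    ∃ p ∈ connectedSubgroup h.heisenberg, ∃ q ∈ connectedSubgroup h.heisenberg,
      p * q ≠ q * p := by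
  have hs := h.isThreeStepNil
  have hX := h.frameVec_mem (.inl (0, ⟨0, hn⟩))
  have hY := h.frameVec_mem (.inl (1, ⟨0, hn⟩))
  have hXY := h.lie_frameVec_inl 0 1 ⟨0, hn⟩ ⟨0, hn⟩
  generalize frameVec e w (.inl (0, ⟨0, hn⟩)) = X at hX hXY
  generalize frameVec e w (.inl (1, ⟨0, hn⟩)) = Y at hY hXY
  refine ⟨expGL X, Subgroup.subset_closure ⟨X, hX, rfl⟩, expGL Y,
    Subgroup.subset_closure ⟨Y, hY, rfl⟩, fun heq => ?_⟩
  rw [hs.expGL_mul hX hY, hs.expGL_mul hY hX] at heq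
  have h1 := hs.expGL_injective
    (h.heisenberg.add_mem (h.heisenberg.add_mem hX hY)
      (h.heisenberg.smul_mem _ (h.heisenberg.lie_mem hX hY)))
    (h.heisenberg.add_mem (h.heisenberg.add_mem hY hX)
      (h.heisenberg.smul_mem _ (h.heisenberg.lie_mem hY hX))) heq
  rw [← lie_skew Y X, add_comm Y X] at h1
  have h2 : ⁅X, Y⁆ = 0 := by
    have h3 := add_left_cancel h1
    rw [smul_neg, ← sub_eq_zero, sub_neg_eq_add, ← add_smul] at h3
    norm_num at h3
    exact h3
  rw [hXY, if_pos rfl] at h2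
  have h3 := h.linearIndependent_frameVec.ne_zero (.inr ())
  exact h3 (by simpa using h2)

end IsAdaptedFrame

end Nilradical

end IwasawaQuadric

end

theorem mainTheorem9 (n : ℕ) (hn : 1 ≤ n)
    (a : Submodule ℝ (IwasawaQuadric.so2 n)) (ha : IwasawaQuadric.IsMaximalAbelian a)
    (H₀ : a) (hH₀ : IwasawaQuadric.IsRegularElement a H₀) :
    ∃ s : LieSubalgebra ℝ (IwasawaQuadric.so2 n),
      -- `S = connectedSubgroup s` is a Lie subgroup of `N` of codimension one, of dimension `2n+1`
      s ≤ IwasawaQuadric.nilradical a H₀ ∧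
      IwasawaQuadric.connectedSubgroup s ≤ IwasawaQuadric.iwasawaGroup a H₀ ∧
      Module.finrank ℝ s + 1 = Module.finrank ℝ (IwasawaQuadric.nilradical a H₀) ∧
      Module.finrank ℝ s = 2 * n + 1 ∧
      -- `S` is not abelian
      (∃ p ∈ IwasawaQuadric.connectedSubgroup s, ∃ q ∈ IwasawaQuadric.connectedSubgroup s,
        p * q ≠ q * p) ∧
      -- `S` with the induced metric is a Ricci soliton, and moreover an algebraic one
      IwasawaQuadric.IsRicciSoliton s (IwasawaQuadric.inducedMetric s) ∧
      IwasawaQuadric.IsAlgebraicRicciSoliton (IwasawaQuadric.inducedMetric s) := by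
  obtain ⟨e, w, f, h⟩ := IwasawaQuadric.exists_adaptedFrame hn ha hH₀
  have hp := ha.prop.1
  obtain ⟨J, η, ζ, κ, l, hH⟩ := h.exists_isHeisenberg
  obtain ⟨d, c, hR⟩ := hH.ricci_eq_dilation
  refine ⟨h.heisenberg, h.heisenberg_le hp, Subgroup.closure_mono ?_, ?_, h.finrank_heisenberg,
    h.exists_not_commute hn, ?_, hH.isAlgebraicRicciSoliton⟩
  · rintro _ ⟨X, hX, rfl⟩
    exact ⟨X, h.heisenberg_le hp hX, rfl⟩
  · rw [h.finrank_heisenberg, h.finrank_nilradical hp]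
  · exact h.isThreeStepNil.isRicciSoliton hH.inner hH.isLeviCivita (hH.dilation d).toLinearMap c
      (hH.dilation_lie d) (hH.dilation_symm d) hR
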